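/- Let $S^{N-1}(\sqrt N)\subset\mathbb R^N$ be the Euclidean sphere of radius $\sqrt N$ centred at the origin, $\sigma^N$ its uniform probability measure, $\gamma$ the standard Gaussian measure on $\mathbb R$, and $H(\mu|\nu)=\int \log\frac{d\mu}{d\nu}\,d\mu\in[0,\infty]$ the relative entropy of probability measures ($+\infty$ if $\mu\not\ll\nu$). For a probability measure $\mu^{(N)}$ on $S^{N-1}(\sqrt N)$ and $1\le k\le N$, let $P_k\mu^{(N)}$ be its marginal on the first $k$ coordinates. A family $\{\mu^{(N)}\}_{N\ge N_0}$, where $N_0\ge 1$ and $\mu^{(N)}$ is a probability measure on $S^{N-1}(\sqrt N)$, is called *entropically $\mu$-chaotic* ($\mu$ a Borel probability measure on $\mathbb R$) if (i) each $\mu^{(N)}$ is invariant under permutations of the coordinates $v_1,\dots,v_N$; (ii) for every $k\ge 1$, $P_k\mu^{(N)}\to\mu^{\otimes k}$ as $N\to\infty$, weakly against bounded continuous functions on $\mathbb R^k$; (iii) $\displaystyle\lim_{N\to\infty}\frac{H(\mu^{(N)}|\sigma^N)}{N}=H(\mu|\gamma)$. Let $f$ be a probability density on $\mathbb R$ with $$\int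 f(v)v^2\,dv=1,\qquad \int f(v)v^4\,dv<\infty,\qquad f\in L^\infty(\mathbb R),$$ let $\mu(dv)=f(v)\,dv$, and put $$Z_N=\int_{S^{N-1}(\sqrt N)}\prod_{j=1}^N f(v_j)\,d\sigma^N(v),\qquad [\mu^{\otimes N}]=\frac{\prod_{j=1}^N f(v_j)}{Z_N}\,\sigma^N .$$ Then there is $N_0\ge 1$ such that $0<Z_N<\infty$ for all $N\ge N_0$ (so that $[\mu^{\otimes N}]$ is a well-defined probability measure on $S^{N-1}(\sqrt N)$ for these $N$), and the family $\{[\mu^{\otimes N}]\}_{N\ge N_0}$ is entropically $\mu$-chaotic. In fact, for every $k\ge1$, $$\lim_{N\to\infty}H\bigl(P_k[\mu^{\otimes N}]\,\big|\,\mu^{\otimes k}\bigr)=0 .$$ Furthermore, for every $N_1\ge1$, any family $\{\mu^{(N)}\}_{N\ge N_1}$ of permutation-symmetric probability measures on $S^{N-1}(\sqrt N)$ with $$\frac1N H\bigl(\mu^{(N)}\,\big|\,[\mu^{\otimes N}]\bigr)\longrightarrow 0\qquad(N\to\infty)$$ is entropically $\mu$-chaotic. -/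

import Mathlib

namespace KacChaos

open MeasureTheory

noncomputable section

/-- The sphere `S^{N-1}(√N)` in `ℝ^N` with its Euclidean norm. -/
abbrev KacSphere (N : ℕ) : Type :=
  Metric.sphere (0 : EuclideanSpace ℝ (Fin N)) (Real.sqrt (N : ℝ))

/-- The dilation by `√N` from the unit sphere onto `S^{N-1}(√N)`. -/
def dilate (N : ℕ) (x : Metric.sphere (0 : EuclideanSpace ℝ (Fin N)) 1) : KacSphere N :=
  ⟨Real.sqrt (N : ℝ) • (x : EuclideanSpace ℝ (Fin N)), by
    rw [mem_sphere_zero_iff_norm, norm_smul, norm_eq_of_mem_sphere x, mul_one,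
      Real.norm_of_nonneg (Real.sqrt_nonneg _)]⟩

/-- The surface measure of the unit sphere of `ℝ^N`. -/
def surfaceMeasure (N : ℕ) : Measure (Metric.sphere (0 : EuclideanSpace ℝ (Fin N)) 1) :=
  (volume : Measure (EuclideanSpace ℝ (Fin N))).toSphere

/-- The uniform probability measure `σ^N` on `S^{N-1}(√N)` (for `N ≥ 1`): the image under the
dilation of the normalized surface measure of the unit sphere. -/
def unif (N : ℕ) : Measure (KacSphere N) :=
  (((surfaceMeasure N) Set.univ)⁻¹ • surfaceMeasure N).map (dilate N)

/-- The measure `f(v) dv` on `ℝ`. -/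
def density (f : ℝ → ℝ) : Measure ℝ :=
  volume.withDensity fun v => ENNReal.ofReal (f v)

/-- The tensor power `μ^{⊗k}` on `ℝ^k`. -/
def tensorPower (μ : Measure ℝ) (k : ℕ) : Measure (Fin k → ℝ) :=
  Measure.pi fun _ => μ

/-- The normalization `Z_N(f, √N)`, the integral of `f^{⊗N}` over `S^{N-1}(√N)` against `σ^N`. -/
def Z (f : ℝ → ℝ) (N : ℕ) : ENNReal :=
  ∫⁻ v : KacSphere N, ∏ j : Fin N, ENNReal.ofReal (f (v.1 j)) ∂(unif N)

/-- The conditioned tensor product `[μ^{⊗N}]` on `S^{N-1}(√N)`, for `μ = f(v) dv`. It is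
meaningful when `0 < Z f N < ∞`. -/
def condProd (f : ℝ → ℝ) (N : ℕ) : Measure (KacSphere N) :=
  (unif N).withDensity fun v => (∏ j : Fin N, ENNReal.ofReal (f (v.1 j))) / Z f N

/-- The marginal `P_k` of a measure on `S^{N-1}(√N)` for the first `k` velocities
(the case `k > N`, where there is no such marginal, is given the value `0`). -/
def marginal {N : ℕ} (k : ℕ) (m : Measure (KacSphere N)) : Measure (Fin k → ℝ) :=
  if h : k ≤ N then m.map fun v i => v.1 (Fin.castLE h i) else 0

/-- Invariance under interchange of the variables: for every permutation `π`, the law of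
`(v_{π 1}, …, v_{π N})` is the law of `(v_1, …, v_N)`. -/
def IsSymm {N : ℕ} (m : Measure (KacSphere N)) : Prop :=
  ∀ π : Equiv.Perm (Fin N),
    m.map (fun v (i : Fin N) => v.1 (π i)) = m.map (fun v (i : Fin N) => v.1 i)

/-- The family `(m N)`, `N ≥ N₀`, consists of symmetric probability measures on the spheres
`S^{N-1}(√N)`. -/
def IsSymmFamily (N₀ : ℕ) (m : (N : ℕ) → Measure (KacSphere N)) : Prop :=
  ∀ N, N₀ ≤ N → IsProbabilityMeasure (m N) ∧ IsSymm (m N)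

/-- The family `(m N)`, `N ≥ N₀`, of probability measures on `S^{N-1}(√N)` is `μ`-chaotic. -/
structure IsChaotic (μ : Measure ℝ) (N₀ : ℕ) (m : (N : ℕ) → Measure (KacSphere N)) : Prop where
  symm : IsSymmFamily N₀ m
  tendsto : ∀ k : ℕ, 0 < k → ∀ χ : BoundedContinuousFunction (Fin k → ℝ) ℝ,
    Filter.Tendsto (fun N : ℕ => ∫ v, χ v ∂(marginal k (m N))) Filter.atTop
      (nhds (∫ v, χ v ∂(tensorPower μ k)))

/-- The family `(m N)`, `N ≥ N₀`, of probability measures on `S^{N-1}(√N)` is entropically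
`μ`-chaotic. Relative entropy `H(·|·)` between probability measures is
`InformationTheory.klDiv`, with values in `[0, ∞]`. -/
structure IsEntropicallyChaotic (μ : Measure ℝ) (N₀ : ℕ)
    (m : (N : ℕ) → Measure (KacSphere N)) : Prop extends IsChaotic μ N₀ m where
  entropy : Filter.Tendsto (fun N : ℕ => InformationTheory.klDiv (m N) (unif N) / (N : ENNReal))
    Filter.atTop (nhds (InformationTheory.klDiv μ (ProbabilityTheory.gaussianReal 0 1)))

end

end KacChaos

namespace KacChaos

open MeasureTheory Filter Topology ProbabilityTheory
open scoped ENNReal NNReal Real FourierTransform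

noncomputable section

/-! The sphere is the level set `∑ v_j² = N`, so everything is governed by the density of a sum of
independent squares near its mean. Slicing the sphere in its first coordinates gives `Z_N = c_N
s_N(N)`, where `s_n` is the density of a sum of `n` squares under `μ` and `c_N` does not depend on
`f` (`Z_eq`). With `r² = ∑ x_i²` over the first `k` coordinates, the `k`-marginal of `[μ^{⊗N}]` has
density `s_{N-k}(N - r²) / s_N(N)` with respect to `μ^{⊗k}` (`marginal_condProd`). The unit second
moment says that `v²` has mean `1`, and the fourth moment that it has finite variance.

A local central limit theorem then gives `√n s_n(n + x) → L > 0` for each fixed `x`, with `√n s_n`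
bounded uniformly (`sumSqDensity_asymptotics`). It needs an integrable power of the characteristic
function of `v²`; since `f` is bounded, `v_1² + v_2²` has bounded density, and the fourth power is
integrable. Hence `0 < Z_N < ∞` eventually, and the marginal densities tend to `1` boundedly, which
is convergence in relative entropy.

For a family at entropy `o(N)` from `[μ^{⊗N}]`, the Donsker-Varadhan inequality is applied to `t ∑
φ(block)` over about `N/k` disjoint blocks of `k` coordinates. Marginals of `[μ^{⊗N}]` on all but
five coordinates are at most `C√N` times the product measure (`exists_lintegral_condProd_le`), so
independence of the blocks costs only `log(C√N) = o(N)`. Dividing by `t` and the number of blocks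
bounds the limiting mean of `φ` by `cgf(t)/t`, which tends to `∫ φ dμ^{⊗k}` as `t → 0`; using `-φ`
as well gives convergence (`tendsto_integral_marginal`).

Bounded continuous `φ` give chaos. The choice `φ = log f`, which is exponentially integrable, gives
the entropy limit through `H(P|σ^N) = H(P|[μ^{⊗N}]) + N ∫ log f dP_1 - log Z_N`. The rate of `log
Z_N` is found by comparison with the Gaussian density, whose product is constant on the sphere
(`tendsto_log_Z_div`). The family `[μ^{⊗N}]` itself is the case of zero entropy distance. -/

/-! ### Fourier inversion for measures on the line. -/

/-- The (real part of the) inverse Fourier transform of a characteristic function `φ`. -/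
def invDensity (φ : ℝ → ℂ) (u : ℝ) : ℝ :=
  (2 * π)⁻¹ * (∫ ξ : ℝ, Complex.exp (-(u * ξ : ℝ) * Complex.I) * φ ξ).re

lemma norm_exp_neg_mul_I (x : ℝ) : ‖Complex.exp (-(x : ℂ) * Complex.I)‖ = 1 := by
  rw [← Complex.ofReal_neg, Complex.norm_exp_ofReal_mul_I]

lemma continuous_invDensity {φ : ℝ → ℂ} (hφ : Integrable φ) : Continuous (invDensity φ) := by
  unfold invDensity
  refine continuous_const.mul (Complex.continuous_re.comp ?_)
  refine continuous_of_dominated (bound := fun ξ => ‖φ ξ‖) (fun u => ?_) (fun u => ?_) hφ.norm ?_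
  · exact (Continuous.aestronglyMeasurable (by fun_prop)).mul hφ.1
  · exact ae_of_all _ fun ξ => by rw [norm_mul, norm_exp_neg_mul_I, one_mul]
  · exact ae_of_all _ fun ξ => by fun_prop

lemma fourier_charFun_comp_re (φ : ℝ → ℂ) (u : ℝ) :
    (𝓕 (fun ξ : ℝ => φ (2 * π * ξ)) u).re = invDensity φ u := by
  have hπ := Real.pi_pos
  rw [invDensity, Real.fourier_real_eq_integral_exp_smul]
  have := Measure.integral_comp_mul_left
    (fun ξ : ℝ => Complex.exp (-(u * ξ : ℝ) * Complex.I) * φ ξ) (2 * π)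
  rw [abs_of_pos (by positivity)] at this
  rw [← Complex.re_ofReal_mul, ← Complex.real_smul, ← this]
  congr 2
  ext ξ
  rw [smul_eq_mul]
  congr 2
  push_cast
  ring

/-- Weak form of the inversion formula: expand `g` by Fourier inversion, exchange the integrals,
then move the transform from `g` to the characteristic function by the duality `∫ ĝ h = ∫ g ĥ`. -/
lemma integral_eq_integral_fourier_charFun (ν : Measure ℝ) [IsFiniteMeasure ν]
    (h : Integrable (charFun ν)) (g : SchwartzMap ℝ ℂ) :
    ∫ x, g x ∂ν = ∫ u, g u * 𝓕 (fun ξ : ℝ => charFun ν (2 * π * ξ)) u := by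
  have hπ := Real.pi_pos
  have hG : Integrable (𝓕 (g : ℝ → ℂ)) := by
    rw [← SchwartzMap.fourier_coe]; exact (𝓕 g).integrable
  have h1 : ∀ x, g x = ∫ ξ : ℝ, Complex.exp ((2 * π * ξ) * x * Complex.I) * 𝓕 (g : ℝ → ℂ) ξ := by
    intro x
    have := congrFun (g.continuous.fourierInv_fourier_eq g.integrable hG) x
    rw [← this, Real.fourierInv_eq']
    congr 1
    ext ξ
    rw [smul_eq_mul]
    congr 2
    simp
    ring
  have h2 : ∫ x, g x ∂ν = ∫ ξ, 𝓕 (g : ℝ → ℂ) ξ * charFun ν (2 * π * ξ) := by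
    calc ∫ x, g x ∂ν
        = ∫ x, (∫ ξ : ℝ, Complex.exp ((2 * π * ξ) * x * Complex.I) * 𝓕 (g : ℝ → ℂ) ξ) ∂ν :=
          integral_congr_ae (ae_of_all _ h1)
      _ = ∫ ξ : ℝ, (∫ x, Complex.exp ((2 * π * ξ) * x * Complex.I) * 𝓕 (g : ℝ → ℂ) ξ ∂ν) := by
          refine integral_integral_swap ?_
          refine (hG.comp_snd ν).mono ?_ (ae_of_all _ fun p => ?_)
          · exact (Continuous.aestronglyMeasurable (by fun_prop)).mul hG.1.comp_snd
          · simp only [Function.uncurry, norm_mul]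
            have : ‖Complex.exp ((2 * π * p.2) * p.1 * Complex.I)‖ = 1 := by
              rw [show ((2 : ℂ) * π * p.2) * p.1 = ((2 * π * p.2 * p.1 : ℝ) : ℂ) by push_cast; ring,
                Complex.norm_exp_ofReal_mul_I]
            rw [this, one_mul]
      _ = _ := by
          congr 1
          ext ξ
          rw [integral_mul_const, charFun_apply_real, mul_comm]
          push_cast
          rfl
  rw [h2]
  have h3 : Integrable (fun ξ : ℝ => charFun ν (2 * π * ξ)) :=
    h.comp_mul_left' (by positivity)
  simpa using! VectorFourier.integral_fourierIntegral_smul_eq_flip (L := innerₗ ℝ) (μ := volume)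
      Real.continuous_fourierChar continuous_inner g.integrable h3

/-- **Fourier inversion for measures**: an absolutely continuous finite measure with integrable
characteristic function has density `invDensity`. -/
theorem eq_withDensity_invDensity (ν : Measure ℝ) [IsFiniteMeasure ν] (hac : ν ≪ volume)
    (h : Integrable (charFun ν)) :
    ν = volume.withDensity (fun u => ENNReal.ofReal (invDensity (charFun ν) u)) := by
  have hcont := continuous_invDensity h
  -- Two locally integrable functions agree a.e. once they agree against smooth compactly supported
  -- tests, and such tests are Schwartz functions.
  have key : ∀ᵐ x, (ν.rnDeriv volume x).toReal = invDensity (charFun ν) x := by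
    refine ae_eq_of_integral_contDiff_smul_eq
      (Measure.integrable_toReal_rnDeriv).locallyIntegrable hcont.locallyIntegrable ?_
    intro g hg hgc
    have hgc' : HasCompactSupport (fun x => (g x : ℂ)) := hgc.comp_left (g := Complex.ofReal) rfl
    have hg' : ContDiff ℝ (⊤ : ℕ∞) (fun x => (g x : ℂ)) := Complex.ofRealCLM.contDiff.comp hg
    let G : SchwartzMap ℝ ℂ := hgc'.toSchwartzMap hg'
    have hG : ∀ x, G x = (g x : ℂ) := fun x => rfl
    have e1 := integral_eq_integral_fourier_charFun ν h G
    have e2 : ∫ x, g x • (ν.rnDeriv volume x).toReal = ∫ x, g x ∂ν := by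
      rw [← integral_rnDeriv_smul hac (f := g)]
      congr 1; ext x; simp [mul_comm]
    rw [e2]
    simp only [hG] at e1
    rw [integral_complex_ofReal] at e1
    have e3 := congrArg Complex.re e1
    rw [Complex.ofReal_re] at e3
    rw [e3]
    have hF : Continuous (𝓕 (fun ξ : ℝ => charFun ν (2 * π * ξ))) := by
      refine VectorFourier.fourierIntegral_continuous Real.continuous_fourierChar
        (by exact continuous_inner) (h.comp_mul_left' (by positivity))
    have h_int : Integrable (fun u => (g u : ℂ) * 𝓕 (fun ξ : ℝ => charFun ν (2 * π * ξ)) u) :=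
      Continuous.integrable_of_hasCompactSupport
        (by have := hg'.continuous; fun_prop) hgc'.mul_right
    rw [show (∫ u, (g u : ℂ) * 𝓕 (fun ξ : ℝ => charFun ν (2 * π * ξ)) u).re
      = ∫ u, ((g u : ℂ) * 𝓕 (fun ξ : ℝ => charFun ν (2 * π * ξ)) u).re from
        (integral_re h_int).symm]
    congr 1
    ext u
    rw [Complex.re_ofReal_mul, fourier_charFun_comp_re, smul_eq_mul]
  conv_lhs => rw [← Measure.withDensity_rnDeriv_eq ν volume hac]
  refine withDensity_congr_ae ?_
  filter_upwards [key, ν.rnDeriv_lt_top volume] with x hx hx'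
  rw [← hx, ENNReal.ofReal_toReal hx'.ne]

/-! ### The local central limit theorem. -/

/-- Equality case of the triangle inequality: modulus `1` at `ξ` would make `exp(iξx)` a.e. equal to
a unimodular constant `c`, so the value at `kξ` would be `c ^ k`, contradicting decay at infinity.
-/
lemma norm_charFun_lt_one_of_tendsto_zero (ν : Measure ℝ) [IsProbabilityMeasure ν]
    (hz : Tendsto (charFun ν) (cocompact ℝ) (𝓝 0)) {ξ : ℝ} (hξ : ξ ≠ 0) :
    ‖charFun ν ξ‖ < 1 := by
  have hle : ∀ᵐ x : ℝ ∂ν, ‖Complex.exp (ξ * x * Complex.I)‖ ≤ 1 := ae_of_all _ fun x => by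
    rw [← Complex.ofReal_mul, Complex.norm_exp_ofReal_mul_I]
  rcases ae_eq_const_or_norm_integral_lt_of_norm_le_const hle with h | h
  · exfalso
    set c := ⨍ x, Complex.exp (ξ * x * Complex.I) ∂ν with hc
    have hc1 : ‖c‖ = 1 := by
      obtain ⟨x, hx⟩ := h.exists
      simp only [Function.const_apply] at hx
      rw [← hx, ← Complex.ofReal_mul, Complex.norm_exp_ofReal_mul_I]
    have hk : ∀ k : ℕ, charFun ν (k * ξ) = c ^ k := by
      intro k
      rw [charFun_apply_real]
      have : (fun x : ℝ => Complex.exp (((k * ξ : ℝ) : ℂ) * x * Complex.I)) =ᵐ[ν]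
          fun _ => c ^ k := by
        filter_upwards [h] with x hx
        simp only [Function.const_apply] at hx
        rw [← hx, ← Complex.exp_nat_mul]
        congr 1; push_cast; ring
      rw [integral_congr_ae this]
      simp
    have ht : Tendsto (fun k : ℕ => (k : ℝ) * ξ) atTop (cocompact ℝ) := by
      rw [← Metric.cobounded_eq_cocompact, ← tendsto_norm_atTop_iff_cobounded]
      simp only [norm_mul, Real.norm_natCast]
      exact tendsto_natCast_atTop_atTop.atTop_mul_const (norm_pos_iff.2 hξ)
    have h0 := (hz.comp ht).norm
    simp only [Function.comp_def, hk, norm_pow, hc1, one_pow, norm_zero] at h0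
    exact one_ne_zero (tendsto_nhds_unique tendsto_const_nhds h0)
  · rw [charFun_apply_real]
    simpa using h

lemma exists_norm_charFun_le_lt_one (ν : Measure ℝ) [IsProbabilityMeasure ν]
    (hz : Tendsto (charFun ν) (cocompact ℝ) (𝓝 0)) {δ : ℝ} (hδ : 0 < δ) :
    ∃ κ, 0 ≤ κ ∧ κ < 1 ∧ ∀ ξ, δ ≤ |ξ| → ‖charFun ν ξ‖ ≤ κ := by
  have h1 : ∀ᶠ ξ in cocompact ℝ, ‖charFun ν ξ‖ ≤ 1 / 2 := by
    have := hz.norm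
    rw [norm_zero] at this
    exact this.eventually_le_const (by norm_num)
  rw [← Metric.cobounded_eq_cocompact, ← comap_norm_atTop, eventually_comap] at h1
  obtain ⟨R, hR⟩ := eventually_atTop.1 h1
  set K : Set ℝ := Metric.closedBall 0 R ∩ {ξ | δ ≤ |ξ|} with hK
  have hKc : IsCompact K := (isCompact_closedBall 0 R).inter_right
    (isClosed_le continuous_const continuous_abs)
  have hcont : Continuous (fun ξ => ‖charFun ν ξ‖) := by
    have : Continuous (charFun ν) := by fun_prop
    exact this.norm
  obtain ⟨κ, hκ1, hκ⟩ : ∃ κ < 1, ∀ ξ ∈ K, ‖charFun ν ξ‖ ≤ κ := by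
    rcases K.eq_empty_or_nonempty with he | hne
    · exact ⟨0, by norm_num, by simp [he]⟩
    · obtain ⟨ξ₀, hξ₀, hmax⟩ := hKc.exists_isMaxOn hne hcont.continuousOn
      refine ⟨_, norm_charFun_lt_one_of_tendsto_zero ν hz (ξ := ξ₀) ?_, fun ξ hξ => hmax hξ⟩
      rintro rfl
      have := hξ₀.2
      simp at this
      linarith
  refine ⟨max κ (1 / 2), by positivity, by simp [hκ1]; norm_num, fun ξ hξ => ?_⟩
  rcases le_or_gt |ξ| R with h | h
  · exact (hκ ξ ⟨by simpa using h, hξ⟩).trans (le_max_left _ _)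
  · exact (hR |ξ| h.le ξ rfl).trans (le_max_right _ _)

lemma exists_norm_charFun_le_exp (ν : Measure ℝ) [IsProbabilityMeasure ν]
    (h0 : ν[fun x => x] = 0) (h1 : ∫ x, x ^ 2 ∂ν = 1) :
    ∃ δ > 0, ∀ ξ, |ξ| ≤ δ → ‖charFun ν ξ‖ ≤ Real.exp (-ξ ^ 2 / 4) := by
  have ht := taylor_charFun_two (P := ν) (X := fun x => x) aemeasurable_id h0 (by simpa using h1)
  -- Allowing an error `ξ²/4` in the expansion `1 - ξ²/2 + o(ξ²)` leaves `1 - ξ²/4 ≤ exp(-ξ²/4)`.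
  have ht' := ht.bound (c := 1 / 4) (by norm_num)
  obtain ⟨ε, hε, hb⟩ := Metric.eventually_nhds_iff.1 ht'
  refine ⟨min (ε / 2) 1, by positivity, fun ξ hξ => ?_⟩
  have h2 := hb (y := ξ) (by
    rw [Real.dist_eq, sub_zero]; linarith [hξ.trans (min_le_left _ _)])
  have h3 : |ξ| ≤ 1 := hξ.trans (min_le_right _ _)
  have hsq : ξ ^ 2 ≤ 1 := by rw [← sq_abs]; nlinarith [abs_nonneg ξ]
  simp only [Measure.map_id', norm_pow] at h2
  have h4 : ‖(ξ : ℝ)‖ ^ 2 = ξ ^ 2 := by rw [Real.norm_eq_abs, sq_abs]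
  rw [h4] at h2
  have h5 : ‖(1 : ℂ) - (ξ : ℂ) ^ 2 / 2‖ = 1 - ξ ^ 2 / 2 := by
    rw [show (1 : ℂ) - (ξ : ℂ) ^ 2 / 2 = ((1 - ξ ^ 2 / 2 : ℝ) : ℂ) by push_cast; ring,
      Complex.norm_real, Real.norm_of_nonneg (by linarith)]
  have h6 : ‖charFun ν ξ‖ ≤ ‖charFun ν ξ - (1 - (ξ : ℂ) ^ 2 / 2)‖ + ‖(1 : ℂ) - (ξ : ℂ) ^ 2 / 2‖ := by
    have := norm_add_le (charFun ν ξ - (1 - (ξ : ℂ) ^ 2 / 2)) (1 - (ξ : ℂ) ^ 2 / 2)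
    rwa [sub_add_cancel] at this
  calc ‖charFun ν ξ‖ ≤ 1 / 4 * ξ ^ 2 + (1 - ξ ^ 2 / 2) := by rw [← h5]; linarith
    _ = (-ξ ^ 2 / 4) + 1 := by ring
    _ ≤ _ := Real.add_one_le_exp _

lemma integrable_exp_neg_sq_div_four : Integrable (fun η : ℝ => Real.exp (-η ^ 2 / 4)) := by
  convert integrable_exp_neg_mul_sq (b := 1 / 4) (by norm_num) using 2
  ring_nf

/-- Splitting of the rescaled powers of a characteristic function into a Gaussian-dominated part
and an exponentially small part. -/
lemma exists_charFun_pow_le (ν : Measure ℝ) [IsProbabilityMeasure ν]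
    (h0 : ν[fun x => x] = 0) (h1 : ∫ x, x ^ 2 ∂ν = 1)
    (hz : Tendsto (charFun ν) (cocompact ℝ) (𝓝 0)) :
    ∃ κ, 0 ≤ κ ∧ κ < 1 ∧ ∃ δ > 0, ∀ m : ℕ, 4 ≤ m →
      (∀ η : ℝ, |η| ≤ δ * √m → ‖charFun ν ((√m)⁻¹ * η)‖ ^ m ≤ Real.exp (-η ^ 2 / 4)) ∧
      (∀ η : ℝ, δ * √m < |η| → ‖charFun ν ((√m)⁻¹ * η)‖ ^ m ≤
        κ ^ (m - 4) * ‖charFun ν ((√m)⁻¹ * η)‖ ^ 4) := by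
  obtain ⟨δ, hδ, hδ'⟩ := exists_norm_charFun_le_exp ν h0 h1
  obtain ⟨κ, hκ0, hκ1, hκ⟩ := exists_norm_charFun_le_lt_one ν hz hδ
  refine ⟨κ, hκ0, hκ1, δ, hδ, fun m hm => ⟨fun η hη => ?_, fun η hη => ?_⟩⟩
  · have hm0 : (0 : ℝ) < m := by positivity
    have hs : 0 < √(m : ℝ) := by positivity
    have := hδ' ((√m)⁻¹ * η) (by
      rw [abs_mul, abs_of_pos (by positivity), inv_mul_le_iff₀ hs, mul_comm]; exact hη)
    calc _ ≤ (Real.exp (-((√m)⁻¹ * η) ^ 2 / 4)) ^ m := by gcongr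
      _ = _ := by
        rw [← Real.exp_nat_mul, mul_pow, inv_pow, Real.sq_sqrt hm0.le]
        congr 1; field_simp
  · have hs : 0 < √(m : ℝ) := by positivity
    have := hκ ((√m)⁻¹ * η) (by
      rw [abs_mul, abs_of_pos (by positivity), le_inv_mul_iff₀ hs, mul_comm]; exact hη.le)
    -- Four factors are kept aside because only the fourth power is assumed integrable; the others
    -- supply the geometric decay.
    calc _ = ‖charFun ν ((√m)⁻¹ * η)‖ ^ (m - 4) * ‖charFun ν ((√m)⁻¹ * η)‖ ^ 4 := by
          rw [← pow_add]; congr 1; omega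
      _ ≤ _ := by gcongr

/-- Rescaling by `√m` multiplies the integral of the fourth power by `√m`; the geometric factor from
high frequencies still wins. -/
lemma tendsto_pow_sub_mul_sqrt {κ : ℝ} (hκ0 : 0 ≤ κ) (hκ1 : κ < 1) (I : ℝ) :
    Tendsto (fun m : ℕ => κ ^ (m - 4) * (√m * I)) atTop (𝓝 0) := by
  rw [← tendsto_add_atTop_iff_nat 4]
  simp only [Nat.add_sub_cancel]
  have h1 : Tendsto (fun n : ℕ => ((n : ℝ) * κ ^ n + 4 * κ ^ n) * |I|) atTop (𝓝 0) := by
    have := ((tendsto_self_mul_const_pow_of_lt_one hκ0 hκ1).add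
      ((tendsto_pow_atTop_nhds_zero_of_lt_one hκ0 hκ1).const_mul 4)).mul_const |I|
    simpa using this
  refine squeeze_zero_norm (fun n => ?_) h1
  have hs : √((n + 4 : ℕ) : ℝ) ≤ n + 4 := by
    push_cast
    exact Real.sqrt_le_self_iff.2 (Or.inr (by linarith [(n.cast_nonneg : (0:ℝ) ≤ n)]))
  rw [norm_mul, norm_mul, norm_pow, Real.norm_of_nonneg hκ0,
    Real.norm_of_nonneg (Real.sqrt_nonneg _), Real.norm_eq_abs]
  calc κ ^ n * (√((n + 4 : ℕ) : ℝ) * |I|) ≤ κ ^ n * ((n + 4) * |I|) := by gcongr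
    _ = _ := by ring

lemma integral_norm_charFun_pow_four_scale (ν : Measure ℝ) (m : ℕ) :
    ∫ η : ℝ, ‖charFun ν ((√m)⁻¹ * η)‖ ^ 4 = √m * ∫ ξ, ‖charFun ν ξ‖ ^ 4 := by
  have := Measure.integral_comp_mul_left (fun ξ : ℝ => ‖charFun ν ξ‖ ^ 4) (√m)⁻¹
  rw [this, inv_inv, abs_of_nonneg (Real.sqrt_nonneg _), smul_eq_mul]

lemma exists_integral_norm_charFun_pow_le (ν : Measure ℝ) [IsProbabilityMeasure ν]
    (h0 : ν[fun x => x] = 0) (h1 : ∫ x, x ^ 2 ∂ν = 1)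
    (hz : Tendsto (charFun ν) (cocompact ℝ) (𝓝 0))
    (h4 : Integrable (fun ξ => ‖charFun ν ξ‖ ^ 4)) :
    ∃ C, ∀ m : ℕ, 4 ≤ m → ∫ η : ℝ, ‖charFun ν ((√m)⁻¹ * η)‖ ^ m ≤ C := by
  obtain ⟨κ, hκ0, hκ1, δ, hδ, H⟩ := exists_charFun_pow_le ν h0 h1 hz
  set I := ∫ ξ, ‖charFun ν ξ‖ ^ 4 with hI
  obtain ⟨B, hB⟩ := (tendsto_pow_sub_mul_sqrt hκ0 hκ1 I).bddAbove_range
  refine ⟨(∫ η : ℝ, Real.exp (-η ^ 2 / 4)) + B, fun m hm => ?_⟩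
  have hs : (√(m : ℝ))⁻¹ ≠ 0 := by positivity
  have hi : Integrable (fun η : ℝ => ‖charFun ν ((√m)⁻¹ * η)‖ ^ 4) := h4.comp_mul_left' hs
  calc ∫ η : ℝ, ‖charFun ν ((√m)⁻¹ * η)‖ ^ m
      ≤ ∫ η : ℝ, (Real.exp (-η ^ 2 / 4) + κ ^ (m - 4) * ‖charFun ν ((√m)⁻¹ * η)‖ ^ 4) := by
        refine integral_mono_of_nonneg (ae_of_all _ fun _ => by positivity)
          (integrable_exp_neg_sq_div_four.add (hi.const_mul _)) (ae_of_all _ fun η => ?_)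
        rcases le_or_gt |η| (δ * √m) with h | h
        · exact ((H m hm).1 η h).trans (le_add_of_nonneg_right (by positivity))
        · exact ((H m hm).2 η h).trans (le_add_of_nonneg_left (by positivity))
    _ = (∫ η : ℝ, Real.exp (-η ^ 2 / 4)) + κ ^ (m - 4) * (√m * I) := by
        rw [integral_add integrable_exp_neg_sq_div_four (hi.const_mul _), integral_const_mul,
          integral_norm_charFun_pow_four_scale]
    _ ≤ _ := by gcongr; exact hB ⟨m, rfl⟩

/-- Split at `|η| = δ√m`. Inside, a fixed Gaussian dominates and the classical central limit theorem
gives the pointwise limit, the phase tending to `1`; outside, the contribution is at most `κ^(m-4)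
√m I`. -/
lemma tendsto_integral_charFun_pow (ν : Measure ℝ) [IsProbabilityMeasure ν]
    (h0 : ν[fun x => x] = 0) (h1 : ∫ x, x ^ 2 ∂ν = 1)
    (hz : Tendsto (charFun ν) (cocompact ℝ) (𝓝 0))
    (h4 : Integrable (fun ξ => ‖charFun ν ξ‖ ^ 4)) {x : ℕ → ℝ} (hx : Tendsto x atTop (𝓝 0)) :
    Tendsto (fun m : ℕ => ∫ η : ℝ,
      Complex.exp (-(x m * η : ℝ) * Complex.I) * charFun ν ((√m)⁻¹ * η) ^ m) atTop
      (𝓝 (∫ η : ℝ, Complex.exp (-η ^ 2 / 2))) := by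
  obtain ⟨κ, hκ0, hκ1, δ, hδ, H⟩ := exists_charFun_pow_le ν h0 h1 hz
  set I := ∫ ξ, ‖charFun ν ξ‖ ^ 4 with hI
  set F : ℕ → ℝ → ℂ := fun m η =>
    Complex.exp (-(x m * η : ℝ) * Complex.I) * charFun ν ((√m)⁻¹ * η) ^ m with hF
  have hFn : ∀ m η, ‖F m η‖ = ‖charFun ν ((√m)⁻¹ * η)‖ ^ m := fun m η => by
    rw [hF]; simp only [norm_mul, norm_exp_neg_mul_I, one_mul, norm_pow]
  have hchar : Continuous (charFun ν) := by fun_prop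
  have hFc : ∀ m, Continuous (F m) := fun m => by simp only [hF]; fun_prop
  set s : ℕ → Set ℝ := fun m => {η | |η| ≤ δ * √m} with hs
  have hsm : ∀ m, MeasurableSet (s m) := fun m =>
    measurableSet_le measurable_abs measurable_const
  have A : Tendsto (fun m => ∫ η, (s m).indicator (F m) η) atTop
      (𝓝 (∫ η : ℝ, Complex.exp (-η ^ 2 / 2))) := by
    refine tendsto_integral_filter_of_dominated_convergence (fun η => Real.exp (-η ^ 2 / 4))
      ?_ ?_ integrable_exp_neg_sq_div_four ?_
    · exact Eventually.of_forall fun m =>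
        ((hFc m).aestronglyMeasurable.indicator (hsm m))
    · filter_upwards [eventually_ge_atTop 4] with m hm
      refine ae_of_all _ fun η => ?_
      by_cases hη : η ∈ s m
      · rw [Set.indicator_of_mem hη, hFn]; exact (H m hm).1 η hη
      · rw [Set.indicator_of_notMem hη, norm_zero]; positivity
    · refine ae_of_all _ fun η => ?_
      have hev : ∀ᶠ m : ℕ in atTop, η ∈ s m := by
        have : Tendsto (fun m : ℕ => δ * √(m : ℝ)) atTop atTop :=
          (Real.tendsto_sqrt_atTop.comp tendsto_natCast_atTop_atTop).const_mul_atTop hδ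
        exact this.eventually_ge_atTop |η|
      have hlim : Tendsto (fun m => F m η) atTop (𝓝 (Complex.exp (-η ^ 2 / 2))) := by
        have e1 := tendsto_charFun_inv_sqrt_mul_pow (P := ν) (X := fun x => x) aemeasurable_id h0
          (by simpa using h1) η
        simp only [Measure.map_id'] at e1
        have e2 : Tendsto (fun m => Complex.exp (-(x m * η : ℝ) * Complex.I)) atTop (𝓝 1) := by
          have : Continuous fun y : ℝ => Complex.exp (-(y * η : ℝ) * Complex.I) := by fun_prop
          have h := (this.tendsto 0).comp hx
          rw [show Complex.exp (-((0 : ℝ) * η : ℝ) * Complex.I) = 1 by simp] at h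
          exact h
        have e3 := e2.mul e1
        rw [one_mul] at e3
        exact e3
      refine hlim.congr' ?_
      filter_upwards [hev] with m hm
      rw [Set.indicator_of_mem hm]
  have hi4 : ∀ m : ℕ, 4 ≤ m → Integrable (fun η : ℝ => ‖charFun ν ((√m)⁻¹ * η)‖ ^ 4) :=
    fun m hm => h4.comp_mul_left' (by positivity)
  have hB : ∀ m : ℕ, 4 ≤ m → ∀ η, ‖(s m)ᶜ.indicator (F m) η‖ ≤
      κ ^ (m - 4) * ‖charFun ν ((√m)⁻¹ * η)‖ ^ 4 := by
    intro m hm η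
    by_cases hη : η ∈ s m
    · rw [Set.indicator_of_notMem (by simpa using hη), norm_zero]; positivity
    · rw [Set.indicator_of_mem hη, hFn]; exact (H m hm).2 η (not_le.1 hη)
  have B : Tendsto (fun m => ∫ η, (s m)ᶜ.indicator (F m) η) atTop (𝓝 0) := by
    refine squeeze_zero_norm' ?_ (tendsto_pow_sub_mul_sqrt hκ0 hκ1 I)
    filter_upwards [eventually_ge_atTop 4] with m hm
    calc _ ≤ ∫ η, ‖(s m)ᶜ.indicator (F m) η‖ := norm_integral_le_integral_norm _
      _ ≤ ∫ η, κ ^ (m - 4) * ‖charFun ν ((√m)⁻¹ * η)‖ ^ 4 :=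
        integral_mono_of_nonneg (ae_of_all _ fun _ => norm_nonneg _) ((hi4 m hm).const_mul _)
          (ae_of_all _ (hB m hm))
      _ = _ := by rw [integral_const_mul, integral_norm_charFun_pow_four_scale]
  have AB := A.add B
  rw [add_zero] at AB
  refine AB.congr' ?_
  filter_upwards [eventually_ge_atTop 4] with m hm
  rw [← integral_add]
  · simp only [Set.indicator_self_add_compl_apply, hF]
  · refine integrable_exp_neg_sq_div_four.mono'
      ((hFc m).aestronglyMeasurable.indicator (hsm m)) (ae_of_all _ fun η => ?_)
    by_cases hη : η ∈ s m
    · rw [Set.indicator_of_mem hη, hFn]; exact (H m hm).1 η hη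
    · rw [Set.indicator_of_notMem hη, norm_zero]; positivity
  · exact ((hi4 m hm).const_mul _).mono'
      ((hFc m).aestronglyMeasurable.indicator (hsm m).compl) (ae_of_all _ (hB m hm))

/-- With zero variance the law would be a point mass, whose characteristic function has modulus `1`
everywhere. -/
lemma variance_ne_zero_of_tendsto_charFun_zero (ν : Measure ℝ) [IsProbabilityMeasure ν]
    (h2 : MemLp (fun x => x) 2 ν) (hz : Tendsto (charFun ν) (cocompact ℝ) (𝓝 0)) :
    Var[fun x => x; ν] ≠ 0 := by
  intro hv
  have hae := ae_eq_integral_of_variance_eq_zero h2 hv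
  have h := norm_charFun_lt_one_of_tendsto_zero ν hz (ξ := 1) one_ne_zero
  rw [charFun_apply_real, integral_congr_ae (g := fun _ => Complex.exp
    ((1 : ℝ) * (ν[fun x => x] : ℝ) * Complex.I))] at h
  · rw [integral_const, probReal_univ, one_smul, ← Complex.ofReal_mul,
      Complex.norm_exp_ofReal_mul_I] at h
    exact lt_irrefl _ h
  · filter_upwards [hae] with x hx
    rw [hx]

lemma charFun_standardize (ν : Measure ℝ) (a : ℝ) {σ : ℝ} (hσ : 0 < σ) (ξ : ℝ) :
    charFun ν ξ = charFun (ν.map (fun x => σ⁻¹ * (x - a))) (σ * ξ) *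
      Complex.exp ((a * ξ : ℝ) * Complex.I) := by
  have hm : (fun x : ℝ => σ⁻¹ * (x - a)) = (fun x => σ⁻¹ * x) ∘ (fun x => x + -a) := by
    ext x; simp [sub_eq_add_neg]
  rw [hm, ← Measure.map_map (by fun_prop) (by fun_prop), charFun_map_mul, ← mul_assoc,
    inv_mul_cancel₀ hσ.ne', one_mul, charFun_map_add_const, mul_assoc, ← Complex.exp_add]
  simp [mul_comm]

/-- **Local central limit theorem** for densities, under integrability of the fourth power of the
characteristic function. -/
theorem local_central_limit (ν : Measure ℝ) [IsProbabilityMeasure ν]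
    (h2 : MemLp (fun x => x) 2 ν) (hz : Tendsto (charFun ν) (cocompact ℝ) (𝓝 0))
    (h4 : Integrable (fun ξ => ‖charFun ν ξ‖ ^ 4)) :
    ∃ L > 0, (∀ x : ℝ, Tendsto (fun m : ℕ =>
      √m * invDensity (fun ξ => charFun ν ξ ^ m) (m * ν[fun x => x] + x)) atTop (𝓝 L)) ∧
      ∃ C, ∀ m : ℕ, 4 ≤ m → ∀ u, √m * |invDensity (fun ξ => charFun ν ξ ^ m) u| ≤ C := by
  have hπ := Real.pi_pos
  set a : ℝ := ν[fun x => x] with ha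
  set σ : ℝ := √Var[fun x => x; ν] with hσdef
  have hvar := variance_ne_zero_of_tendsto_charFun_zero ν h2 hz
  have hvarpos : 0 < Var[fun x => x; ν] := lt_of_le_of_ne (variance_nonneg _ _) hvar.symm
  have hσ : 0 < σ := Real.sqrt_pos.2 hvarpos
  set ν₀ := ν.map (fun x => σ⁻¹ * (x - a)) with hν₀
  have : IsProbabilityMeasure ν₀ := Measure.isProbabilityMeasure_map (by fun_prop)
  have h_int : Integrable (fun x => x) ν := h2.integrable (by norm_num)
  have hstd : ∀ ξ, charFun ν ξ = charFun ν₀ (σ * ξ) * Complex.exp ((a * ξ : ℝ) * Complex.I) :=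
    charFun_standardize ν a hσ
  have hnorm : ∀ ξ, ‖charFun ν₀ ξ‖ = ‖charFun ν (σ⁻¹ * ξ)‖ := fun ξ => by
    rw [hstd, norm_mul, Complex.norm_exp_ofReal_mul_I, mul_one, mul_inv_cancel_left₀ hσ.ne']
  have m0 : ν₀[fun x => x] = 0 := by
    rw [hν₀, integral_map (by fun_prop) (by fun_prop), integral_const_mul,
      integral_sub h_int (integrable_const _)]
    simp [ha]
  have m1 : ∫ x, x ^ 2 ∂ν₀ = 1 := by
    rw [hν₀, integral_map (by fun_prop) (by fun_prop)]
    simp only [mul_pow]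
    rw [integral_const_mul, ha, ← variance_eq_integral (by fun_prop), inv_pow, hσdef,
      Real.sq_sqrt hvarpos.le, inv_mul_cancel₀ hvar]
  have hz₀ : Tendsto (charFun ν₀) (cocompact ℝ) (𝓝 0) := by
    rw [tendsto_zero_iff_norm_tendsto_zero]
    simp only [hnorm]
    have hc : Tendsto (fun ξ : ℝ => σ⁻¹ * ξ) (cocompact ℝ) (cocompact ℝ) :=
      (Homeomorph.mulLeft₀ σ⁻¹ (by positivity)).isClosedEmbedding.tendsto_cocompact
    exact (tendsto_zero_iff_norm_tendsto_zero.1 hz).comp hc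
  have h4₀ : Integrable (fun ξ => ‖charFun ν₀ ξ‖ ^ 4) := by
    simp only [hnorm]
    exact h4.comp_mul_left' (by positivity)
  -- Substitute `η = σ√m ξ` after standardizing. At `u = ma + x` the phase parameter is `x / (σ√m) →
  -- 0`, which is why the limit does not depend on `x`.
  have key : ∀ m : ℕ, 4 ≤ m → ∀ u, √m * invDensity (fun ξ => charFun ν ξ ^ m) u =
      (2 * π * σ)⁻¹ * (∫ η : ℝ, Complex.exp (-(((u - m * a) / (σ * √m)) * η : ℝ) * Complex.I) *
        charFun ν₀ ((√m)⁻¹ * η) ^ m).re := by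
    intro m hm u
    have hs : 0 < √(m : ℝ) := by positivity
    have hsub := Measure.integral_comp_mul_left
      (fun η : ℝ => Complex.exp (-(((u - m * a) / (σ * √m)) * η : ℝ) * Complex.I) *
        charFun ν₀ ((√m)⁻¹ * η) ^ m) (σ * √m)
    rw [abs_of_pos (by positivity)] at hsub
    have hcongr : ∫ ξ : ℝ, Complex.exp (-(u * ξ : ℝ) * Complex.I) * charFun ν ξ ^ m =
        ∫ ξ : ℝ, Complex.exp (-(((u - m * a) / (σ * √m)) * (σ * √m * ξ) : ℝ) * Complex.I) *
        charFun ν₀ ((√m)⁻¹ * (σ * √m * ξ)) ^ m := by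
      congr 1
      ext ξ
      rw [hstd ξ, mul_pow, ← Complex.exp_nat_mul, mul_left_comm, mul_comm, ← Complex.exp_add,
        show (√(m : ℝ))⁻¹ * (σ * √m * ξ) = σ * ξ by field_simp,
        show ((u - m * a) / (σ * √m)) * (σ * √m * ξ) = (u - m * a) * ξ by field_simp]
      congr 2
      push_cast
      ring
    rw [invDensity, hcongr, hsub, Complex.real_smul, Complex.re_ofReal_mul]
    generalize Complex.re _ = R
    field_simp
  refine ⟨(2 * π * σ)⁻¹ * (∫ η : ℝ, Complex.exp (-η ^ 2 / 2)).re, ?_, fun x => ?_, ?_⟩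
  · have : (∫ η : ℝ, Complex.exp (-η ^ 2 / 2)) = ((∫ η : ℝ, Real.exp (-(1 / 2) * η ^ 2) : ℝ) : ℂ) := by
      rw [← integral_complex_ofReal]
      congr 1; ext η; push_cast; ring_nf
    rw [this, Complex.ofReal_re, integral_gaussian]
    positivity
  · have hx : Tendsto (fun m : ℕ => x / (σ * √(m : ℝ))) atTop (𝓝 0) :=
      tendsto_const_nhds.div_atTop
        ((Real.tendsto_sqrt_atTop.comp tendsto_natCast_atTop_atTop).const_mul_atTop hσ)
    have ht := tendsto_integral_charFun_pow ν₀ m0 m1 hz₀ h4₀ hx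
    refine (((Complex.continuous_re.tendsto _).comp ht).const_mul ((2 * π * σ)⁻¹)).congr' ?_
    filter_upwards [eventually_ge_atTop 4] with m hm
    rw [key m hm, add_sub_cancel_left]
    rfl
  · obtain ⟨C, hC⟩ := exists_integral_norm_charFun_pow_le ν₀ m0 m1 hz₀ h4₀
    refine ⟨(2 * π * σ)⁻¹ * C, fun m hm u => ?_⟩
    rw [← abs_of_nonneg (Real.sqrt_nonneg (m : ℝ)), ← abs_mul, key m hm, abs_mul,
      abs_of_pos (show 0 < (2 * π * σ)⁻¹ by positivity)]
    gcongr
    refine (Complex.abs_re_le_norm _).trans ((norm_integral_le_integral_norm _).trans ?_)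
    refine le_trans (le_of_eq ?_) (hC m hm)
    simp only [norm_mul, norm_exp_neg_mul_I, one_mul, norm_pow]

/-! ### The law of a square, and the integrable fourth power of its characteristic function. -/

/-- The substitution `z = ±√w` on the real line. -/
lemma lintegral_eq_lintegral_sqrt {G : ℝ → ℝ≥0∞} (hG : Measurable G) :
    ∫⁻ z, G z = ∫⁻ w in Set.Ioi 0, ENNReal.ofReal (1 / (2 * √w)) * (G √w + G (-√w)) := by
  have hd : ∀ w ∈ Set.Ioi (0 : ℝ), HasDerivAt Real.sqrt (1 / (2 * √w)) w := fun w hw =>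
    Real.hasDerivAt_sqrt (ne_of_gt hw)
  have himg : Real.sqrt '' Set.Ioi 0 = Set.Ioi 0 := by
    ext z
    constructor
    · rintro ⟨w, hw, rfl⟩
      exact Real.sqrt_pos.2 hw
    · intro hz
      exact ⟨z ^ 2, pow_pos (Set.mem_Ioi.1 hz) 2, Real.sqrt_sq (le_of_lt hz)⟩
  have himg' : (fun w => -√w) '' Set.Ioi 0 = Set.Iio 0 := by
    have : (fun w => -√w) = (fun w => -w) ∘ Real.sqrt := rfl
    rw [this, Set.image_comp, himg]
    simp
  have hinj : Set.InjOn Real.sqrt (Set.Ioi 0) := fun x hx y hy h =>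
    (Real.sqrt_inj (le_of_lt hx) (le_of_lt hy)).1 h
  have e1 := lintegral_image_eq_lintegral_abs_deriv_mul measurableSet_Ioi
    (fun w hw => (hd w hw).hasDerivWithinAt) hinj G
  have e2 := lintegral_image_eq_lintegral_abs_deriv_mul measurableSet_Ioi
    (fun w hw => (hd w hw).neg.hasDerivWithinAt) (fun x hx y hy h => hinj hx hy (neg_injective h)) G
  change ∫⁻ x in (fun w => -√w) '' Set.Ioi 0, G x = _ at e2
  rw [himg] at e1
  rw [himg'] at e2
  simp only [abs_neg] at e2
  have hsplit : ∫⁻ z, G z = (∫⁻ z in Set.Ioi 0, G z) + ∫⁻ z in Set.Iio 0, G z := by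
    rw [← lintegral_add_compl _ (measurableSet_Ioi (a := (0 : ℝ))), Set.compl_Ioi,
      setLIntegral_congr Iio_ae_eq_Iic.symm]
  rw [hsplit, e1, e2, ← lintegral_add_left (by fun_prop)]
  refine setLIntegral_congr_fun measurableSet_Ioi fun w hw => ?_
  have : |1 / (2 * √w)| = 1 / (2 * √w) := abs_of_nonneg (by positivity)
  simp only [this, mul_add]
  rfl

/-- The density of `v ↦ v²` when `v` has density `g`. -/
def sqDensity (g : ℝ → ℝ≥0∞) (w : ℝ) : ℝ≥0∞ :=
  (Set.Ioi (0 : ℝ)).indicator (fun w => ENNReal.ofReal (1 / (2 * √w)) * (g √w + g (-√w))) w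

lemma measurable_sqDensity {g : ℝ → ℝ≥0∞} (hg : Measurable g) : Measurable (sqDensity g) :=
  Measurable.indicator (by fun_prop) measurableSet_Ioi

lemma lintegral_comp_sq_mul {g : ℝ → ℝ≥0∞} (hg : Measurable g) {h : ℝ → ℝ≥0∞} (hh : Measurable h) :
    ∫⁻ v, h (v ^ 2) * g v = ∫⁻ w, h w * sqDensity g w := by
  rw [lintegral_eq_lintegral_sqrt (by fun_prop), ← lintegral_indicator measurableSet_Ioi]
  congr 1
  ext w
  unfold sqDensity
  by_cases hw : w ∈ Set.Ioi (0 : ℝ)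
  · rw [Set.indicator_of_mem hw, Set.indicator_of_mem hw, neg_sq, Real.sq_sqrt (le_of_lt hw)]
    ring
  · rw [Set.indicator_of_notMem hw, Set.indicator_of_notMem hw, mul_zero]

lemma map_sq_withDensity {g : ℝ → ℝ≥0∞} (hg : Measurable g) :
    (volume.withDensity g).map (fun v => v ^ 2) = volume.withDensity (sqDensity g) := by
  refine Measure.ext_of_lintegral _ fun h hh => ?_
  rw [lintegral_map hh (by fun_prop), lintegral_withDensity_eq_lintegral_mul _ hg (by fun_prop),
    lintegral_withDensity_eq_lintegral_mul _ (measurable_sqDensity hg) hh]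
  simp only [Pi.mul_apply]
  simp_rw [mul_comm (g _), mul_comm (sqDensity g _)]
  exact lintegral_comp_sq_mul hg hh

/-- **Riemann-Lebesgue lemma** for characteristic functions. -/
lemma tendsto_charFun_cocompact (ν : Measure ℝ) [IsFiniteMeasure ν] (hac : ν ≪ volume) :
    Tendsto (charFun ν) (cocompact ℝ) (𝓝 0) := by
  have h := Real.tendsto_integral_exp_smul_cocompact
    (fun x => ((ν.rnDeriv volume x).toReal : ℂ))
  -- This rescaling turns the kernel `exp(-2πi wx)` into `exp(iξx)`.
  have hc : Tendsto (fun ξ : ℝ => (-(2 * π)⁻¹) * ξ) (cocompact ℝ) (cocompact ℝ) :=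
    (Homeomorph.mulLeft₀ (-(2 * π)⁻¹) (by
      have := Real.pi_pos; exact neg_ne_zero.2 (by positivity))).isClosedEmbedding.tendsto_cocompact
  refine (h.comp hc).congr fun ξ => ?_
  rw [charFun_apply_real, ← integral_rnDeriv_smul hac]
  simp only [Function.comp]
  congr 1
  ext x
  rw [Circle.smul_def, Real.fourierChar_apply, Complex.real_smul, smul_eq_mul, mul_comm]
  congr 2
  have := Real.pi_pos
  push_cast
  have hpi : (π : ℂ) ≠ 0 := by exact_mod_cast this.ne'
  field_simp

lemma lintegral_le_of_le_smul {ρ : Measure ℝ} {K : ℝ≥0∞} (h : ρ ≤ K • volume) (G : ℝ → ℝ≥0∞) :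
    ∫⁻ x, G x ∂ρ ≤ K * ∫⁻ x, G x := by
  rw [← smul_eq_mul, ← lintegral_smul_measure]
  exact lintegral_mono' h le_rfl

/-- By translation invariance of Lebesgue measure, convolving with a probability measure does not
raise a density bound. -/
lemma conv_le_smul_volume {ρ ρ' : Measure ℝ} [SFinite ρ] [IsProbabilityMeasure ρ'] {K : ℝ≥0∞}
    (h : ρ ≤ K • volume) : ρ' ∗ ρ ≤ K • volume := by
  refine Measure.le_iff.2 fun s hs => ?_
  rw [← lintegral_indicator_one hs, Measure.lintegral_conv (measurable_one.indicator hs)]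
  calc ∫⁻ x, ∫⁻ y, s.indicator 1 (x + y) ∂ρ ∂ρ'
      ≤ ∫⁻ x, (K * ∫⁻ y, s.indicator 1 (x + y)) ∂ρ' :=
        lintegral_mono fun x => lintegral_le_of_le_smul h _
    _ = ∫⁻ x, K * volume s ∂ρ' := by
        refine lintegral_congr fun x => ?_
        rw [lintegral_add_left_eq_self (fun y => s.indicator 1 y) x, lintegral_indicator_one hs]
    _ = (K • volume) s := by simp

lemma integral_norm_charFun_mul_gaussian (τ : Measure ℝ) [IsFiniteMeasure τ]
    (hpos : ∀ ξ, charFun τ ξ = (‖charFun τ ξ‖ : ℂ)) {b : ℝ} (hb : 0 < b) :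
    ∫ ξ : ℝ, ‖charFun τ ξ‖ * Real.exp (-b * ξ ^ 2) =
      √(π / b) * ∫ x : ℝ, Real.exp (-(1 / (4 * b)) * x ^ 2) ∂τ := by
  have hπ := Real.pi_pos
  have hg : Integrable (fun ξ : ℝ => Complex.exp (-b * ξ ^ 2)) := by
    have := (integrable_exp_neg_mul_sq hb).ofReal (𝕜 := ℂ)
    convert this using 2
    simp
  have e1 : ∫ ξ : ℝ, charFun τ ξ * Complex.exp (-b * ξ ^ 2) =
      ∫ x : ℝ, (∫ ξ : ℝ, Complex.exp (Complex.I * x * ξ) * Complex.exp (-b * ξ ^ 2)) ∂τ := by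
    rw [integral_integral_swap]
    · congr 1
      ext ξ
      rw [charFun_apply_real, ← integral_mul_const]
      congr 1
      ext x
      congr 2
      ring
    · refine (hg.comp_snd τ).mono (Continuous.aestronglyMeasurable (by fun_prop))
        (ae_of_all _ fun p => ?_)
      simp only [Function.uncurry, norm_mul]
      rw [show Complex.I * (p.1 : ℂ) * p.2 = ((p.1 * p.2 : ℝ) : ℂ) * Complex.I by push_cast; ring,
        Complex.norm_exp_ofReal_mul_I, one_mul]
  have e2 : ∀ x : ℝ, (∫ ξ : ℝ, Complex.exp (Complex.I * x * ξ) * Complex.exp (-b * ξ ^ 2)) =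
      ((√(π / b) * Real.exp (-(1 / (4 * b)) * x ^ 2) : ℝ) : ℂ) := by
    intro x
    rw [fourierIntegral_gaussian (by simpa using hb)]
    push_cast
    congr 1
    · rw [Real.sqrt_eq_rpow, Complex.ofReal_cpow (by positivity)]
      push_cast
      rfl
    · congr 1
      ring
  simp only [e2] at e1
  rw [integral_complex_ofReal, integral_const_mul] at e1
  have e3 : ∫ ξ : ℝ, charFun τ ξ * Complex.exp (-b * ξ ^ 2) =
      ((∫ ξ : ℝ, ‖charFun τ ξ‖ * Real.exp (-b * ξ ^ 2) : ℝ) : ℂ) := by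
    rw [← integral_complex_ofReal]
    congr 1
    ext ξ
    rw [hpos ξ]
    push_cast
    simp
  rw [e3] at e1
  exact_mod_cast e1

/-- Integrate against `exp(-bξ²)`. By Fubini this is a Gaussian integral against `τ`, and the two
normalizations `√(π/b)` and `√(4πb)` multiply to `2π`, so the bound `2πK` is uniform in `b`. Since
the characteristic function is nonnegative there is no cancellation, and Fatou's lemma with `b → 0`
concludes. -/
lemma integrable_charFun_of_le_smul_volume (τ : Measure ℝ) [IsFiniteMeasure τ] {K : ℝ≥0∞}
    (hK : K ≠ ⊤) (h : τ ≤ K • volume) (hpos : ∀ ξ, charFun τ ξ = (‖charFun τ ξ‖ : ℂ)) :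
    Integrable (charFun τ) := by
  have hπ := Real.pi_pos
  have hcont : Continuous (charFun τ) := by fun_prop
  have hb : ∀ b : ℝ, 0 < b →
      ∫⁻ ξ : ℝ, ENNReal.ofReal (‖charFun τ ξ‖ * Real.exp (-b * ξ ^ 2)) ≤
        ENNReal.ofReal (2 * π) * K := by
    intro b hb
    have hi : Integrable (fun ξ : ℝ => ‖charFun τ ξ‖ * Real.exp (-b * ξ ^ 2)) := by
      refine ((integrable_exp_neg_mul_sq hb).const_mul (τ.real Set.univ)).mono'
        (Continuous.aestronglyMeasurable (by fun_prop)) (ae_of_all _ fun ξ => ?_)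
      rw [norm_mul, norm_norm, Real.norm_of_nonneg (Real.exp_pos _).le]
      gcongr
      exact norm_charFun_le _
    have hgauss : ∫⁻ x : ℝ, ENNReal.ofReal (Real.exp (-(1 / (4 * b)) * x ^ 2)) =
        ENNReal.ofReal √(π / (1 / (4 * b))) := by
      rw [← integral_gaussian, ofReal_integral_eq_lintegral_ofReal
        (integrable_exp_neg_mul_sq (by positivity)) (ae_of_all _ fun _ => (Real.exp_pos _).le)]
    have hτi : Integrable (fun x : ℝ => Real.exp (-(1 / (4 * b)) * x ^ 2)) τ := by
      refine (integrable_const (1 : ℝ)).mono' (Continuous.aestronglyMeasurable (by fun_prop))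
        (ae_of_all _ fun x => ?_)
      rw [Real.norm_of_nonneg (Real.exp_pos _).le, Real.exp_le_one_iff]
      have : 0 ≤ 1 / (4 * b) * x ^ 2 := by positivity
      linarith
    rw [← ofReal_integral_eq_lintegral_ofReal hi (ae_of_all _ fun _ => by positivity),
      integral_norm_charFun_mul_gaussian τ hpos hb, ENNReal.ofReal_mul (by positivity),
      ofReal_integral_eq_lintegral_ofReal hτi (ae_of_all _ fun _ => (Real.exp_pos _).le)]
    calc _ ≤ ENNReal.ofReal √(π / b) * (K * ENNReal.ofReal √(π / (1 / (4 * b)))) := by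
          gcongr
          rw [← hgauss]
          exact lintegral_le_of_le_smul h _
      _ = _ := by
          rw [mul_left_comm, ← ENNReal.ofReal_mul (by positivity), ← Real.sqrt_mul (by positivity),
            show π / b * (π / (1 / (4 * b))) = (2 * π) ^ 2 by field_simp; ring,
            Real.sqrt_sq (by positivity), mul_comm]
  refine ⟨hcont.aestronglyMeasurable, ?_⟩
  rw [hasFiniteIntegral_iff_norm]
  have hlim : ∀ ξ : ℝ, Tendsto (fun n : ℕ => ENNReal.ofReal (‖charFun τ ξ‖ *
      Real.exp (-(1 / ((n : ℝ) + 1)) * ξ ^ 2))) atTop (𝓝 (ENNReal.ofReal ‖charFun τ ξ‖)) := by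
    intro ξ
    refine ENNReal.tendsto_ofReal ?_
    have h1 : Tendsto (fun n : ℕ => -(1 / ((n : ℝ) + 1)) * ξ ^ 2) atTop (𝓝 0) := by
      simpa using (tendsto_one_div_add_atTop_nhds_zero_nat (𝕜 := ℝ)).neg.mul_const (ξ ^ 2)
    have h2 := ((Real.continuous_exp.tendsto 0).comp h1).const_mul ‖charFun τ ξ‖
    rw [Real.exp_zero, mul_one] at h2
    exact h2
  calc ∫⁻ ξ, ENNReal.ofReal ‖charFun τ ξ‖
      = ∫⁻ ξ : ℝ, liminf (fun n : ℕ => ENNReal.ofReal (‖charFun τ ξ‖ *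
          Real.exp (-(1 / ((n : ℝ) + 1)) * ξ ^ 2))) atTop :=
        lintegral_congr fun ξ => (hlim ξ).liminf_eq.symm
    _ ≤ liminf (fun n : ℕ => ∫⁻ ξ : ℝ, ENNReal.ofReal (‖charFun τ ξ‖ *
          Real.exp (-(1 / ((n : ℝ) + 1)) * ξ ^ 2))) atTop :=
        lintegral_liminf_le fun n => by
          have : Continuous (fun ξ : ℝ => ‖charFun τ ξ‖ *
            Real.exp (-(1 / ((n : ℝ) + 1)) * ξ ^ 2)) := by fun_prop
          exact this.measurable.ennreal_ofReal
    _ ≤ liminf (fun n : ℕ => ENNReal.ofReal (2 * π) * K) atTop :=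
        liminf_le_liminf (Eventually.of_forall fun n => hb _ (by positivity))
    _ < ⊤ := by
        rw [liminf_const]
        exact ENNReal.mul_lt_top ENNReal.ofReal_lt_top hK.lt_top

lemma charFun_map_neg (ρ : Measure ℝ) (ξ : ℝ) :
    charFun (ρ.map (fun x => -x)) ξ = (starRingEnd ℂ) (charFun ρ ξ) := by
  rw [← charFun_neg]
  simpa using charFun_map_mul (μ := ρ) (-1) ξ

/-- The sum of two independent squares has bounded density if the density of `v` is bounded. -/
lemma conv_map_sq_le {g : ℝ → ℝ≥0∞} [IsFiniteMeasure (volume.withDensity g)]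
    {M : ℝ≥0∞} (hM : ∀ v, g v ≤ M) :
    ((volume.withDensity g).map (fun v => v ^ 2)) ∗ ((volume.withDensity g).map (fun v => v ^ 2))
      ≤ (M * M * ENNReal.ofReal π) • volume := by
  set μ := volume.withDensity g with hμ
  have hμle : μ ≤ M • volume := by
    refine Measure.le_iff.2 fun s hs => ?_
    rw [hμ, withDensity_apply _ hs, Measure.smul_apply, smul_eq_mul, ← setLIntegral_const]
    exact lintegral_mono hM
  refine Measure.le_iff.2 fun s hs => ?_
  have hm : Measurable (s.indicator (1 : ℝ → ℝ≥0∞)) := measurable_one.indicator hs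
  set h := s.indicator (1 : ℝ → ℝ≥0∞) with hh
  rw [← lintegral_indicator_one hs, Measure.lintegral_conv hm, lintegral_map (by
    exact Measurable.lintegral_prod_right (by fun_prop)) (by fun_prop)]
  have e1 : ∀ x : ℝ, ∫⁻ y, h (x ^ 2 + y) ∂(μ.map (fun v => v ^ 2)) = ∫⁻ y, h (x ^ 2 + y ^ 2) ∂μ :=
    fun x => lintegral_map (by fun_prop) (by fun_prop)
  simp only [e1]
  calc ∫⁻ x, ∫⁻ y, h (x ^ 2 + y ^ 2) ∂μ ∂μ
      ≤ ∫⁻ x, (M * ∫⁻ y, h (x ^ 2 + y ^ 2)) ∂μ :=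
        lintegral_mono fun x => lintegral_le_of_le_smul hμle _
    _ ≤ M * ∫⁻ x, M * ∫⁻ y, h (x ^ 2 + y ^ 2) := lintegral_le_of_le_smul hμle _
    _ = M * M * ∫⁻ p : ℝ × ℝ, h (p.1 ^ 2 + p.2 ^ 2) := by
        rw [lintegral_const_mul _ (Measurable.lintegral_prod_right (by fun_prop)), ← mul_assoc,
          Measure.volume_eq_prod, lintegral_prod _ (by fun_prop)]
    -- Polar coordinates: the angle gives `2π` and `r dr = dw/2` for `w = r²`.
    _ = M * M * (ENNReal.ofReal π * ∫⁻ w in Set.Ioi 0, h w) := by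
        congr 1
        rw [← lintegral_comp_polarCoord_symm, polarCoord_target, Measure.volume_eq_prod,
          ← Measure.prod_restrict, lintegral_prod _ (by fun_prop)]
        have himg : (fun x : ℝ => x ^ 2) '' Set.Ioi 0 = Set.Ioi 0 := by
          ext z
          constructor
          · rintro ⟨w, hw, rfl⟩
            exact pow_pos (Set.mem_Ioi.1 hw) 2
          · intro hz
            exact ⟨√z, Real.sqrt_pos.2 hz, Real.sq_sqrt (le_of_lt hz)⟩
        have e2 := lintegral_image_eq_lintegral_abs_deriv_mul (measurableSet_Ioi (a := (0 : ℝ)))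
          (fun x _ => (hasDerivAt_pow 2 x).hasDerivWithinAt)
          (fun x hx y hy hxy => (pow_left_inj₀ (le_of_lt hx) (le_of_lt hy) two_ne_zero).1 hxy) h
        change ∫⁻ x in (fun x : ℝ => x ^ 2) '' Set.Ioi 0, h x = _ at e2
        rw [himg] at e2
        rw [e2, ← lintegral_const_mul _ (by fun_prop)]
        refine setLIntegral_congr_fun measurableSet_Ioi fun x hx => ?_
        have hx' : 0 < x := hx
        have e3 : ∀ y : ℝ, (polarCoord.symm (x, y)).1 ^ 2 + (polarCoord.symm (x, y)).2 ^ 2 = x ^ 2 := by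
          intro y
          simp only [polarCoord_symm_apply]
          rw [mul_pow, mul_pow, ← mul_add, Real.cos_sq_add_sin_sq, mul_one]
        simp only [e3, smul_eq_mul, lintegral_const, Measure.restrict_apply MeasurableSet.univ,
          Set.univ_inter, Real.volume_Ioo]
        rw [mul_right_comm, ← ENNReal.ofReal_mul hx'.le, ← mul_assoc,
          ← ENNReal.ofReal_mul Real.pi_pos.le]
        congr 2
        simp only [Nat.cast_ofNat, Nat.add_one_sub_one, pow_one]
        rw [abs_of_pos (by positivity)]
        ring
    _ ≤ _ := by
        rw [Measure.smul_apply, smul_eq_mul, ← mul_assoc, ← lintegral_indicator_one hs]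
        gcongr
        exact Measure.restrict_le_self

/-- Convolving `ν ∗ ν` with its reflection keeps the density bounded and makes the characteristic
function equal to the nonnegative `‖charFun ν‖ ^ 4`. -/
lemma integrable_norm_charFun_pow_four {g : ℝ → ℝ≥0∞}
    [IsProbabilityMeasure (volume.withDensity g)] {M : ℝ≥0∞} (hM : M ≠ ⊤) (hgM : ∀ v, g v ≤ M) :
    Integrable (fun ξ => ‖charFun ((volume.withDensity g).map (fun v => v ^ 2)) ξ‖ ^ 4) := by
  set ν := (volume.withDensity g).map (fun v => v ^ 2) with hν
  have : IsProbabilityMeasure ν := Measure.isProbabilityMeasure_map (by fun_prop)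
  have : IsProbabilityMeasure ((ν ∗ ν).map (fun x => -x)) :=
    Measure.isProbabilityMeasure_map (by fun_prop)
  have hle := conv_le_smul_volume (ρ' := (ν ∗ ν).map (fun x => -x)) (conv_map_sq_le hgM)
  rw [← hν] at hle
  have hchar : ∀ ξ, charFun ((ν ∗ ν).map (fun x => -x) ∗ (ν ∗ ν)) ξ = ((‖charFun ν ξ‖ ^ 4 : ℝ) : ℂ) := by
    intro ξ
    rw [charFun_conv, charFun_map_neg, charFun_conv, mul_comm, Complex.mul_conj,
      Complex.normSq_eq_norm_sq, norm_mul]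
    congr 1
    ring
  have hnorm : ∀ ξ, ‖charFun ((ν ∗ ν).map (fun x => -x) ∗ (ν ∗ ν)) ξ‖ = ‖charFun ν ξ‖ ^ 4 := by
    intro ξ
    rw [hchar, Complex.norm_real, Real.norm_of_nonneg (by positivity)]
  have := (integrable_charFun_of_le_smul_volume _
    (ENNReal.mul_ne_top (ENNReal.mul_ne_top hM hM) ENNReal.ofReal_ne_top) hle
    (fun ξ => by rw [hnorm, hchar])).norm
  simpa only [hnorm] using this

/-! ### Densities of sums of independent squares. -/

/-- The law of `∑ vᵢ²` under `μ^{⊗m}`. -/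
def sumSqLaw (μ : Measure ℝ) (m : ℕ) : Measure ℝ :=
  (tensorPower μ m).map (fun y => ∑ i, y i ^ 2)

@[fun_prop]
lemma measurable_sum_sq (m : ℕ) : Measurable (fun y : Fin m → ℝ => ∑ i, y i ^ 2) :=
  (continuous_finsetSum _ fun i _ => (continuous_apply i).pow 2).measurable

instance (μ : Measure ℝ) [IsProbabilityMeasure μ] (m : ℕ) :
    IsProbabilityMeasure (tensorPower μ m) := by
  unfold tensorPower; infer_instance

instance (μ : Measure ℝ) [IsProbabilityMeasure μ] (m : ℕ) :
    IsProbabilityMeasure (sumSqLaw μ m) :=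
  Measure.isProbabilityMeasure_map (measurable_sum_sq m).aemeasurable

lemma charFun_sumSqLaw (μ : Measure ℝ) [IsProbabilityMeasure μ] (m : ℕ) (ξ : ℝ) :
    charFun (sumSqLaw μ m) ξ = charFun (μ.map (fun v => v ^ 2)) ξ ^ m := by
  rw [charFun_apply_real, charFun_apply_real, sumSqLaw,
    integral_map (measurable_sum_sq m).aemeasurable
    (Continuous.aestronglyMeasurable (by fun_prop)), integral_map (by fun_prop)
    (Continuous.aestronglyMeasurable (by fun_prop)), tensorPower]
  have := integral_fintype_prod_eq_pow (ι := Fin m) (μ := μ)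
    (fun v : ℝ => Complex.exp (ξ * ((v ^ 2 : ℝ) : ℂ) * Complex.I))
  rw [Fintype.card_fin] at this
  rw [← this]
  congr 1
  ext y
  rw [← Complex.exp_sum]
  congr 1
  push_cast
  rw [Finset.mul_sum, Finset.sum_mul]

/-- Absolute continuity comes from splitting off one square. For `m ≥ 4` the `m`-th power of the
characteristic function is dominated by the integrable fourth power, so inversion applies. -/
lemma sumSqLaw_eq_withDensity {g : ℝ → ℝ≥0∞} (hg : Measurable g)
    [IsProbabilityMeasure (volume.withDensity g)] {M : ℝ≥0∞} (hM : M ≠ ⊤) (hgM : ∀ v, g v ≤ M)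
    {m : ℕ} (hm : 4 ≤ m) :
    sumSqLaw (volume.withDensity g) m = volume.withDensity (fun u => ENNReal.ofReal (invDensity
      (fun ξ => charFun ((volume.withDensity g).map (fun v => v ^ 2)) ξ ^ m) u)) := by
  set μ := volume.withDensity g with hμ
  set ν := μ.map (fun v => v ^ 2) with hν
  have : IsProbabilityMeasure ν := Measure.isProbabilityMeasure_map (by fun_prop)
  have hνac : ν ≪ volume := by
    rw [hν, hμ, map_sq_withDensity hg]
    exact withDensity_absolutelyContinuous _ _
  have hchar : charFun (sumSqLaw μ m) = fun ξ => charFun ν ξ ^ m :=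
    funext fun ξ => charFun_sumSqLaw μ m ξ
  have hac : sumSqLaw μ m ≪ volume := by
    obtain ⟨j, rfl⟩ : ∃ j, m = j + 1 := ⟨m - 1, by omega⟩
    have : sumSqLaw μ (j + 1) = sumSqLaw μ j ∗ ν := by
      refine Measure.ext_of_charFun (funext fun ξ => ?_)
      rw [charFun_conv, charFun_sumSqLaw, charFun_sumSqLaw, pow_succ]
    rw [this]
    exact Measure.conv_absolutelyContinuous hνac
  have h_int : Integrable (charFun (sumSqLaw μ m)) := by
    rw [hchar]
    have hcont : Continuous (charFun ν) := by fun_prop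
    refine (integrable_norm_charFun_pow_four hM hgM).mono'
      (by fun_prop) (ae_of_all _ fun ξ => ?_)
    rw [norm_pow]
    exact pow_le_pow_of_le_one (norm_nonneg _) (norm_charFun_le_one _) hm
  rw [← hchar]
  exact eq_withDensity_invDensity _ hac h_int

section

/-- A bounded measurable probability density with unit second and finite fourth moment. -/
structure IsKacDensity (f : ℝ → ℝ) : Prop where
  measurable : Measurable f
  nonneg : ∀ v, 0 ≤ f v
  bdd : ∃ M, ∀ v, f v ≤ M
  one : ∫ v, f v = 1
  two : ∫ v, f v * v ^ 2 = 1
  four : Integrable (fun v => f v * v ^ 4)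

namespace IsKacDensity

variable {f : ℝ → ℝ}

lemma integrable (hf : IsKacDensity f) : Integrable f :=
  Integrable.of_integral_ne_zero (by rw [hf.one]; exact one_ne_zero)

lemma integrable_two (hf : IsKacDensity f) : Integrable (fun v => f v * v ^ 2) :=
  Integrable.of_integral_ne_zero (by rw [hf.two]; exact one_ne_zero)

lemma measurable_ofReal (hf : IsKacDensity f) : Measurable (fun v => ENNReal.ofReal (f v)) :=
  hf.measurable.ennreal_ofReal

lemma isProbabilityMeasure (hf : IsKacDensity f) : IsProbabilityMeasure (density f) := by
  constructor
  rw [density, withDensity_apply _ MeasurableSet.univ, setLIntegral_univ,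
    ← ofReal_integral_eq_lintegral_ofReal hf.integrable (ae_of_all _ hf.nonneg), hf.one,
    ENNReal.ofReal_one]

lemma integral_density (hf : IsKacDensity f) (h : ℝ → ℝ) :
    ∫ v, h v ∂(density f) = ∫ v, f v * h v := by
  rw [density, integral_withDensity_eq_integral_toReal_smul hf.measurable_ofReal
    (ae_of_all _ fun _ => ENNReal.ofReal_lt_top)]
  simp [ENNReal.toReal_ofReal (hf.nonneg _)]

lemma integrable_density_iff (hf : IsKacDensity f) {h : ℝ → ℝ} :
    Integrable h (density f) ↔ Integrable (fun v => f v * h v) := by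
  rw [density, integrable_withDensity_iff_integrable_smul₀' hf.measurable_ofReal.aemeasurable
    (ae_of_all _ fun _ => ENNReal.ofReal_lt_top)]
  simp [ENNReal.toReal_ofReal (hf.nonneg _)]

end IsKacDensity

/-- The density at `r` of the sum of `m + 1` independent squares, in convolution form. -/
def sumSqDensity (f : ℝ → ℝ) (m : ℕ) (r : ℝ) : ℝ≥0∞ :=
  ∫⁻ y, sqDensity (fun v => ENNReal.ofReal (f v)) (r - ∑ i, y i ^ 2) ∂(tensorPower (density f) m)

lemma measurable_sumSqDensity {f : ℝ → ℝ} (hf : IsKacDensity f) (m : ℕ) :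
    Measurable (sumSqDensity f m) := by
  have := hf.isProbabilityMeasure
  unfold sumSqDensity
  refine Measurable.lintegral_prod_right'
    (f := fun p : ℝ × (Fin m → ℝ) => sqDensity (fun v => ENNReal.ofReal (f v))
      (p.1 - ∑ i, p.2 i ^ 2)) ?_
  exact (measurable_sqDensity hf.measurable_ofReal).comp
    (measurable_fst.sub ((measurable_sum_sq m).comp measurable_snd))

/-- The roles of the last square and of the other `m` are exchanged: the convolution against the
possibly singular density of one square becomes an average of the continuous density of `m` squares.
The identity holds at every `r`, which matters because the sphere fixes a single value of the sum.
-/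
lemma sumSqDensity_eq {f : ℝ → ℝ} (hf : IsKacDensity f) {m : ℕ} (hm : 4 ≤ m) (r : ℝ) :
    sumSqDensity f m r = ∫⁻ v, ENNReal.ofReal (invDensity
      (fun ξ => charFun ((density f).map (fun v => v ^ 2)) ξ ^ m) (r - v ^ 2)) ∂(density f) := by
  have := hf.isProbabilityMeasure
  have hprob : IsProbabilityMeasure (volume.withDensity fun v => ENNReal.ofReal (f v)) := this
  set g := fun v => ENNReal.ofReal (f v) with hg
  have hgm : Measurable g := hf.measurable_ofReal
  have hsq := measurable_sqDensity hgm
  obtain ⟨M, hM⟩ := hf.bdd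
  have hlaw := sumSqLaw_eq_withDensity hgm (M := ENNReal.ofReal M) ENNReal.ofReal_ne_top
    (fun v => ENNReal.ofReal_le_ofReal (hM v)) hm
  change sumSqLaw (density f) m = volume.withDensity (fun u => ENNReal.ofReal (invDensity
      (fun ξ => charFun ((density f).map (fun v => v ^ 2)) ξ ^ m) u)) at hlaw
  set s := invDensity (fun ξ => charFun ((density f).map (fun v => v ^ 2)) ξ ^ m) with hs
  have : IsProbabilityMeasure ((density f).map (fun v => v ^ 2)) :=
    Measure.isProbabilityMeasure_map (by fun_prop)
  have hsc : Continuous s := by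
    refine continuous_invDensity ?_
    have hcont : Continuous (charFun ((density f).map (fun v => v ^ 2))) := by fun_prop
    refine (integrable_norm_charFun_pow_four (g := g) ENNReal.ofReal_ne_top
      (fun v => ENNReal.ofReal_le_ofReal (hM v))).mono' (by fun_prop) (ae_of_all _ fun ξ => ?_)
    rw [norm_pow]
    exact pow_le_pow_of_le_one (norm_nonneg _) (norm_charFun_le_one _) hm
  have hsm : Measurable (fun u => ENNReal.ofReal (s u)) := hsc.measurable.ennreal_ofReal
  calc sumSqDensity f m r = ∫⁻ u, sqDensity g (r - u) ∂(sumSqLaw (density f) m) := by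
        rw [sumSqLaw, lintegral_map (by fun_prop) (measurable_sum_sq m)]
        rfl
    _ = ∫⁻ u, ENNReal.ofReal (s u) * sqDensity g (r - u) := by
        rw [hlaw, lintegral_withDensity_eq_lintegral_mul _ hsm (by fun_prop)]
        rfl
    _ = ∫⁻ w, ENNReal.ofReal (s (r - w)) * sqDensity g w := by
        rw [← lintegral_sub_left_eq_self _ r]
        simp only [sub_sub_cancel]
    _ = ∫⁻ v, ENNReal.ofReal (s (r - v ^ 2)) * g v := by
        rw [lintegral_comp_sq_mul hgm (h := fun w => ENNReal.ofReal (s (r - w))) (by fun_prop)]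
    _ = _ := by
        rw [density, lintegral_withDensity_eq_lintegral_mul _ hgm (by fun_prop)]
        simp only [Pi.mul_apply, mul_comm]

/-- Local limit asymptotics of `sumSqDensity`. -/
theorem sumSqDensity_asymptotics {f : ℝ → ℝ} (hf : IsKacDensity f) :
    ∃ L > 0, (∀ x : ℝ, Tendsto (fun m : ℕ => √m * (sumSqDensity f m (m + x)).toReal) atTop (𝓝 L)) ∧
      ∃ C > 0, ∀ m : ℕ, 4 ≤ m → ∀ r, ENNReal.ofReal √m * sumSqDensity f m r ≤ ENNReal.ofReal C := by
  have := hf.isProbabilityMeasure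
  have hprob : IsProbabilityMeasure (volume.withDensity fun v => ENNReal.ofReal (f v)) := this
  set ν := (density f).map (fun v => v ^ 2) with hν
  have : IsProbabilityMeasure ν := Measure.isProbabilityMeasure_map (by fun_prop)
  obtain ⟨M, hM⟩ := hf.bdd
  have h4 : Integrable (fun ξ => ‖charFun ν ξ‖ ^ 4) :=
    integrable_norm_charFun_pow_four (g := fun v => ENNReal.ofReal (f v)) ENNReal.ofReal_ne_top
      (fun v => ENNReal.ofReal_le_ofReal (hM v))
  have hz : Tendsto (charFun ν) (cocompact ℝ) (𝓝 0) := by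
    refine tendsto_charFun_cocompact ν ?_
    rw [hν, density, map_sq_withDensity hf.measurable_ofReal]
    exact withDensity_absolutelyContinuous _ _
  -- The second moment of the law of `v²` is the fourth moment of `f`.
  have h2 : MemLp (fun x => x) 2 ν := by
    rw [hν, memLp_map_measure_iff (by fun_prop) (by fun_prop), Function.comp_def,
      memLp_two_iff_integrable_sq (by fun_prop), hf.integrable_density_iff]
    convert hf.four using 2
    ring
  have hmean : ν[fun x => x] = 1 := by
    rw [hν, integral_map (by fun_prop) (by fun_prop), hf.integral_density, hf.two]
  obtain ⟨L, hL, hlim, C, hC⟩ := local_central_limit ν h2 hz h4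
  rw [hmean] at hlim
  simp only [mul_one] at hlim
  have hcont : Continuous (charFun ν) := by fun_prop
  have hsc : ∀ m : ℕ, 4 ≤ m → Continuous (invDensity (fun ξ => charFun ν ξ ^ m)) := by
    intro m hm
    refine continuous_invDensity (h4.mono' (by fun_prop) (ae_of_all _ fun ξ => ?_))
    rw [norm_pow]
    exact pow_le_pow_of_le_one (norm_nonneg _) (norm_charFun_le_one _) hm
  have hC' : ∀ m : ℕ, 4 ≤ m → ∀ u,
      √m * max (invDensity (fun ξ => charFun ν ξ ^ m) u) 0 ≤ max C 1 := by
    intro m hm u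
    refine le_trans ?_ ((hC m hm u).trans (le_max_left _ _))
    gcongr
    exact max_le (le_abs_self _) (abs_nonneg _)
  refine ⟨L, hL, fun x => ?_, max C 1, by positivity, fun m hm r => ?_⟩
  · have hdct : Tendsto (fun m : ℕ => ∫ v, √m * max (invDensity (fun ξ => charFun ν ξ ^ m)
        (m + x - v ^ 2)) 0 ∂(density f)) atTop (𝓝 (∫ _, L ∂(density f))) := by
      refine tendsto_integral_filter_of_dominated_convergence (fun _ => max C 1) ?_ ?_
        (integrable_const _) ?_
      · filter_upwards [eventually_ge_atTop 4] with m hm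
        have := hsc m hm
        exact Continuous.aestronglyMeasurable (by fun_prop)
      · filter_upwards [eventually_ge_atTop 4] with m hm
        refine ae_of_all _ fun v => ?_
        rw [Real.norm_of_nonneg (by positivity)]
        exact hC' m hm _
      · refine ae_of_all _ fun v => ?_
        have h := (hlim (x - v ^ 2)).max (tendsto_const_nhds (x := (0 : ℝ)))
        rw [max_eq_left hL.le] at h
        refine h.congr fun m => ?_
        rw [mul_max_of_nonneg _ _ (Real.sqrt_nonneg _), mul_zero, add_sub_assoc]
    rw [integral_const, probReal_univ, one_smul] at hdct
    refine hdct.congr' ?_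
    filter_upwards [eventually_ge_atTop 4] with m hm
    have hc := hsc m hm
    rw [integral_const_mul, sumSqDensity_eq hf hm]
    congr 1
    rw [integral_eq_lintegral_of_nonneg_ae (f := fun v => max (invDensity
      (fun ξ => charFun ν ξ ^ m) (m + x - v ^ 2)) 0) (ae_of_all _ fun _ => le_max_right _ _)
      (Continuous.aestronglyMeasurable (by fun_prop))]
    simp [hν]
  · rw [sumSqDensity_eq hf hm, ← lintegral_const_mul' _ _ ENNReal.ofReal_ne_top]
    calc _ ≤ ∫⁻ v, ENNReal.ofReal (max C 1) ∂(density f) := by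
          refine lintegral_mono fun v => ?_
          rw [← ENNReal.ofReal_mul (Real.sqrt_nonneg _)]
          refine ENNReal.ofReal_le_ofReal (le_trans ?_ (hC' m hm (r - v ^ 2)))
          gcongr
          exact le_max_left _ _
      _ = _ := by simp

end

/-! ### The uniform measure on the sphere and its slicing. -/

lemma measurable_dilate (N : ℕ) : Measurable (dilate N) :=
  Measurable.subtype_mk (by fun_prop)

lemma isProbabilityMeasure_unif {N : ℕ} (hN : N ≠ 0) : IsProbabilityMeasure (unif N) := by
  have : NeZero N := ⟨hN⟩
  have hne : (surfaceMeasure N) Set.univ ≠ 0 := by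
    rw [Ne, Measure.measure_univ_eq_zero]
    exact Measure.toSphere_ne_zero _
  have hfin : (surfaceMeasure N) Set.univ ≠ ⊤ := by
    unfold surfaceMeasure
    exact measure_ne_top _ _
  have : IsProbabilityMeasure (((surfaceMeasure N) Set.univ)⁻¹ • surfaceMeasure N) := by
    constructor
    rw [Measure.smul_apply, smul_eq_mul, ENNReal.inv_mul_cancel hne hfin]
  exact Measure.isProbabilityMeasure_map (measurable_dilate N).aemeasurable

/-- The projection of `ℝ^N ∖ {0}` onto the sphere of radius `√N`. -/
def radialProj {N : ℕ} (x : Fin N → ℝ) : Fin N → ℝ := (√N / √(∑ i, x i ^ 2)) • x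

lemma measurable_radialProj {N : ℕ} : Measurable (radialProj (N := N)) := by
  unfold radialProj
  exact (measurable_const.div (measurable_sum_sq N).sqrt).smul measurable_id

/-- `Measure.toSphere` measures a set by the volume of the cone over it in the unit ball, and that
cone is the preimage of the set under normalization. -/
lemma map_toSphere_val (N : ℕ) :
    (surfaceMeasure N).map Subtype.val =
      (N : ℝ≥0∞) • ((volume.restrict (Metric.ball (0 : EuclideanSpace ℝ (Fin N)) 1 \ {0})).map
        (fun x => ‖x‖⁻¹ • x)) := by
  ext s hs
  have hm : Measurable (fun x : EuclideanSpace ℝ (Fin N) => ‖x‖⁻¹ • x) := by fun_prop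
  rw [Measure.map_apply measurable_subtype_coe hs, surfaceMeasure,
    Measure.toSphere_apply' _ (measurable_subtype_coe hs), finrank_euclideanSpace_fin,
    Measure.smul_apply, smul_eq_mul, Measure.map_apply hm hs, Measure.restrict_apply (hm hs)]
  congr 2
  ext x
  rw [Set.mem_smul]
  constructor
  · rintro ⟨r, hr, _, ⟨y, hy, rfl⟩, rfl⟩
    have hy1 : ‖(y : EuclideanSpace ℝ (Fin N))‖ = 1 := norm_eq_of_mem_sphere y
    have hnorm : ‖r • (y : EuclideanSpace ℝ (Fin N))‖ = r := by
      rw [norm_smul, hy1, mul_one, Real.norm_of_nonneg hr.1.le]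
    refine ⟨?_, ?_, ?_⟩
    · rw [Set.mem_preimage, hnorm, smul_smul, inv_mul_cancel₀ hr.1.ne', one_smul]
      exact hy
    · rw [mem_ball_zero_iff, hnorm]; exact hr.2
    · rw [Set.mem_singleton_iff, ← norm_eq_zero, hnorm]; exact hr.1.ne'
  · rintro ⟨hx, hb, h0⟩
    have h0' : 0 < ‖x‖ := norm_pos_iff.2 h0
    refine ⟨‖x‖, ⟨h0', by simpa using hb⟩, ‖x‖⁻¹ • x, ⟨⟨‖x‖⁻¹ • x, ?_⟩, hx, rfl⟩, ?_⟩
    · rw [mem_sphere_zero_iff_norm, norm_smul, norm_inv, norm_norm, inv_mul_cancel₀ h0'.ne']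
    · rw [smul_smul, mul_inv_cancel₀ h0'.ne', one_smul]

/-- Spherical integrals become Lebesgue integrals of radially constant functions over a ball, so
permutation invariance and slicing reduce to facts about Lebesgue measure. -/
lemma lintegral_unif_eq_ball (N : ℕ) : ∃ c : ℝ≥0∞, ∀ F : (Fin N → ℝ) → ℝ≥0∞, Measurable F →
    ∫⁻ v : KacSphere N, F (fun i => v.1 i) ∂(unif N) =
      c * ∫⁻ x : Fin N → ℝ, (Set.Ioo (0 : ℝ) 1).indicator 1 (∑ i, x i ^ 2) * F (radialProj x) := by
  refine ⟨((surfaceMeasure N) Set.univ)⁻¹ * N, fun F hF => ?_⟩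
  have hF' : Measurable (fun x : EuclideanSpace ℝ (Fin N) => F (fun i => x i)) :=
    hF.comp (WithLp.measurable_ofLp 2 _)
  have hmeas : Measurable (fun x : EuclideanSpace ℝ (Fin N) => F (fun i => (√N • x) i)) :=
    hF'.comp (measurable_const_smul (√N))
  have hF'' : Measurable (fun v : KacSphere N => F (fun i => v.1 i)) :=
    hF'.comp measurable_subtype_coe
  rw [unif, lintegral_map hF'' (measurable_dilate N),
    lintegral_smul_measure, smul_eq_mul, mul_assoc]
  congr 1
  have e1 : ∫⁻ x, F (fun i => (dilate N x).1 i) ∂(surfaceMeasure N) =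
      ∫⁻ x, F (fun i => (√N • x) i)
        ∂((surfaceMeasure N).map Subtype.val) := by
    rw [lintegral_map hmeas measurable_subtype_coe]
    rfl
  rw [e1, map_toSphere_val, lintegral_smul_measure, smul_eq_mul,
    lintegral_map hmeas (by fun_prop)]
  congr 1
  have hball : MeasurableSet (Metric.ball (0 : EuclideanSpace ℝ (Fin N)) 1 \ {0}) :=
    measurableSet_ball.diff (measurableSet_singleton 0)
  rw [← lintegral_indicator hball]
  rw [← (PiLp.volume_preserving_ofLp (Fin N)).lintegral_comp_emb
    (MeasurableEquiv.toLp 2 (Fin N → ℝ)).symm.measurableEmbedding]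
  congr 1
  ext x
  have hsum : ∑ i, x.ofLp i ^ 2 = ‖x‖ ^ 2 := by
    rw [EuclideanSpace.norm_sq_eq]; simp
  have hmem : x ∈ Metric.ball (0 : EuclideanSpace ℝ (Fin N)) 1 \ {0} ↔
      ∑ i, x.ofLp i ^ 2 ∈ Set.Ioo (0 : ℝ) 1 := by
    rw [hsum, Set.mem_sdiff, mem_ball_zero_iff, Set.mem_singleton_iff, Set.mem_Ioo]
    constructor
    · rintro ⟨h1, h2⟩
      exact ⟨pow_pos (norm_pos_iff.2 h2) 2, pow_lt_one₀ (norm_nonneg _) h1 two_ne_zero⟩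
    · rintro ⟨h1, h2⟩
      refine ⟨by_contra fun h => ?_, fun h => by simp [h] at h1⟩
      exact absurd (one_le_pow₀ (not_lt.1 h) (n := 2)) (not_le.2 h2)
  by_cases hx : x ∈ Metric.ball (0 : EuclideanSpace ℝ (Fin N)) 1 \ {0}
  · rw [Set.indicator_of_mem hx, Set.indicator_of_mem (hmem.1 hx), Pi.one_apply, one_mul]
    congr 1
    ext i
    rw [radialProj, hsum, Real.sqrt_sq (norm_nonneg _)]
    simp [div_eq_mul_inv, mul_assoc]
  · rw [Set.indicator_of_notMem hx, Set.indicator_of_notMem (fun h => hx (hmem.2 h)), zero_mul]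

lemma measurePreserving_comp_perm {ι : Type*} [Fintype ι] (μ : Measure ℝ) [SigmaFinite μ]
    (τ : Equiv.Perm ι) :
    MeasurePreserving (fun (x : ι → ℝ) i => x (τ i)) (Measure.pi fun _ => μ)
      (Measure.pi fun _ => μ) := by
  have := measurePreserving_piCongrLeft (α := fun _ : ι => ℝ) (fun _ => μ) τ.symm
  convert this using 1
  ext x i
  rw [MeasurableEquiv.coe_piCongrLeft, Equiv.piCongrLeft_apply]
  simp

/-- The uniform measure on the sphere is invariant under permutations of the coordinates. -/
lemma lintegral_unif_comp_perm {N : ℕ} (τ : Equiv.Perm (Fin N)) {F : (Fin N → ℝ) → ℝ≥0∞}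
    (hF : Measurable F) :
    ∫⁻ v : KacSphere N, F (fun i => v.1 (τ i)) ∂(unif N) =
      ∫⁻ v : KacSphere N, F (fun i => v.1 i) ∂(unif N) := by
  obtain ⟨c, hc⟩ := lintegral_unif_eq_ball N
  have hperm : Measurable (fun (x : Fin N → ℝ) i => x (τ i)) := by fun_prop
  rw [hc F hF]
  have := hc (fun x => F (fun i => x (τ i))) (hF.comp hperm)
  rw [this]
  congr 1
  have hmp : MeasurePreserving (fun (x : Fin N → ℝ) i => x (τ i)) volume volume :=
    measurePreserving_comp_perm volume τ
  rw [← hmp.lintegral_comp (f := fun x => (Set.Ioo (0 : ℝ) 1).indicator 1 (∑ i, x i ^ 2) *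
    F (radialProj x))]
  · congr 1
    ext x
    have : ∑ i, x (τ i) ^ 2 = ∑ i, x i ^ 2 := Equiv.sum_comp τ (fun i => x i ^ 2)
    simp only [radialProj, this]
    rfl
  · exact ((measurable_one.indicator measurableSet_Ioo).comp (measurable_sum_sq N)).mul
      (hF.comp measurable_radialProj)

/-- Appending a last coordinate. -/
def append {n : ℕ} (y : Fin n → ℝ) (z : ℝ) : Fin (n + 1) → ℝ := Fin.snoc (α := fun _ => ℝ) y z

@[simp] lemma append_castSucc {n : ℕ} (y : Fin n → ℝ) (z : ℝ) (i : Fin n) :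
    append y z i.castSucc = y i := Fin.snoc_castSucc (α := fun _ => ℝ) _ _ _

@[simp] lemma append_last {n : ℕ} (y : Fin n → ℝ) (z : ℝ) :
    append y z (Fin.last n) = z := Fin.snoc_last (α := fun _ => ℝ) _ _

lemma measurable_append {n : ℕ} : Measurable (fun p : (Fin n → ℝ) × ℝ => append p.1 p.2) := by
  refine measurable_pi_iff.2 fun i => ?_
  refine Fin.lastCases ?_ (fun j => ?_) i
  · simpa using measurable_snd
  · simp only [append_castSucc]
    fun_prop

lemma smul_append {n : ℕ} (a : ℝ) (y : Fin n → ℝ) (z : ℝ) :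
    a • append y z = append (a • y) (a * z) := by
  ext i
  refine Fin.lastCases ?_ (fun j => ?_) i <;> simp

lemma sum_sq_append {n : ℕ} (y : Fin n → ℝ) (z : ℝ) :
    ∑ i, append y z i ^ 2 = ∑ i, y i ^ 2 + z ^ 2 := by
  rw [Fin.sum_univ_castSucc]; simp

lemma lintegral_tensorPower_succ (μ : Measure ℝ) [SigmaFinite μ] {n : ℕ}
    {K : (Fin (n + 1) → ℝ) → ℝ≥0∞} (hK : Measurable K) :
    ∫⁻ x, K x ∂(tensorPower μ (n + 1)) =
      ∫⁻ y, ∫⁻ z, K (append y z) ∂μ ∂(tensorPower μ n) := by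
  have h := (measurePreserving_piFinSuccAbove (fun _ : Fin (n + 1) => μ) (Fin.last n)).symm
  rw [tensorPower, ← h.lintegral_comp hK, lintegral_prod_symm _ (by
    exact (hK.comp (MeasurableEquiv.measurable _)).aemeasurable)]
  refine lintegral_congr fun y => lintegral_congr fun z => ?_
  congr 1
  exact Fin.insertNth_last (α := fun _ => ℝ) z y

lemma lintegral_append {n : ℕ} {K : (Fin (n + 1) → ℝ) → ℝ≥0∞} (hK : Measurable K) :
    ∫⁻ x, K x = ∫⁻ y : Fin n → ℝ, ∫⁻ z, K (append y z) :=
  lintegral_tensorPower_succ volume hK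

lemma sqDensity_scale {g : ℝ → ℝ≥0∞} {a : ℝ} (ha : 0 < a) (w : ℝ) :
    sqDensity (fun z => g (a⁻¹ * z)) (a ^ 2 * w) = ENNReal.ofReal a⁻¹ * sqDensity g w := by
  unfold sqDensity
  by_cases hw : w ∈ Set.Ioi (0 : ℝ)
  · have hw' : a ^ 2 * w ∈ Set.Ioi (0 : ℝ) := mul_pos (pow_pos ha 2) hw
    rw [Set.indicator_of_mem hw, Set.indicator_of_mem hw', Real.sqrt_mul (by positivity),
      Real.sqrt_sq ha.le]
    beta_reduce
    rw [mul_neg, inv_mul_cancel_left₀ ha.ne', ← mul_assoc (ENNReal.ofReal _),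
      ← ENNReal.ofReal_mul (by positivity)]
    congr 2
    rw [mul_left_comm, one_div, mul_inv, one_div]
  · have hw' : a ^ 2 * w ∉ Set.Ioi (0 : ℝ) := fun h =>
      hw (pos_of_mul_pos_right h (pow_pos ha 2).le)
    rw [Set.indicator_of_notMem hw, Set.indicator_of_notMem hw', mul_zero]

lemma lintegral_comp_smul_pi {n : ℕ} {a : ℝ} (ha : 0 < a) {G : (Fin n → ℝ) → ℝ≥0∞}
    (hG : Measurable G) : ∫⁻ y, G y = ENNReal.ofReal (a ^ n) * ∫⁻ y, G (a • y) := by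
  have h := Measure.map_addHaar_smul (volume : Measure (Fin n → ℝ)) ha.ne'
  have e : ∫⁻ y, G (a • y) = ENNReal.ofReal |(a ^ n)⁻¹| * ∫⁻ y, G y := by
    rw [← lintegral_map hG (measurable_const_smul a), h, lintegral_smul_measure]
    simp
  rw [e, ← mul_assoc, ← ENNReal.ofReal_mul (by positivity), abs_of_pos (by positivity),
    mul_inv_cancel₀ (by positivity), ENNReal.ofReal_one, one_mul]

lemma measurable_sqDensity_append {α : Type*} [MeasurableSpace α] {n : ℕ}
    {G : (Fin (n + 1) → ℝ) → ℝ≥0∞} (hG : Measurable G) {Y : α → Fin n → ℝ} (hY : Measurable Y)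
    {h : α → ℝ} (hh : Measurable h) :
    Measurable fun p : α => sqDensity (fun z => G (append (Y p) z)) (h p) := by
  unfold sqDensity
  simp only [Set.indicator_apply]
  refine Measurable.ite (hh measurableSet_Ioi) ?_ measurable_const
  refine Measurable.mul (by fun_prop) (Measurable.add ?_ ?_)
  · exact hG.comp (measurable_append.comp (hY.prodMk hh.sqrt))
  · exact hG.comp (measurable_append.comp (hY.prodMk hh.sqrt.neg))

/-- Spheres of different radii carry the same integral of a radially constant function up to a power
of the ratio of radii: scaling `y` gives `a ^ n` and the density of the squared last coordinate
gives `a⁻¹`. -/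
lemma lintegral_slice_scale {n : ℕ} {F : (Fin (n + 1) → ℝ) → ℝ≥0∞} (hF : Measurable F)
    {a : ℝ} (ha : 0 < a) (N : ℝ) :
    ∫⁻ y : Fin n → ℝ, sqDensity (fun z => F (a⁻¹ • append y z)) (a ^ 2 * N - ∑ i, y i ^ 2) =
      ENNReal.ofReal (a ^ n) * ENNReal.ofReal a⁻¹ *
        ∫⁻ y : Fin n → ℝ, sqDensity (fun z => F (append y z)) (N - ∑ i, y i ^ 2) := by
  have hm := measurable_sqDensity_append (n := n) (G := fun x => F (a⁻¹ • x))
    (hF.comp (measurable_const_smul _)) measurable_id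
    (measurable_const.sub (measurable_sum_sq n) : Measurable fun y => a ^ 2 * N - ∑ i, y i ^ 2)
  simp only [id, Pi.sub_apply] at hm
  rw [lintegral_comp_smul_pi ha hm, mul_assoc,
    ← lintegral_const_mul' (ENNReal.ofReal a⁻¹) _ ENNReal.ofReal_ne_top]
  congr 1
  refine lintegral_congr fun y => ?_
  rw [← sqDensity_scale ha]
  congr 1
  · ext z
    rw [smul_append, smul_smul, inv_mul_cancel₀ ha.ne', one_smul]
  · simp only [Pi.smul_apply, smul_eq_mul, mul_pow]
    rw [← Finset.mul_sum, mul_sub]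

/-- **Slicing of the sphere**: the uniform measure on `S^n(√(n+1))` in the coordinates
`(y, ±√(n + 1 - |y|²))`. -/
theorem lintegral_unif_eq_slice (n : ℕ) : ∃ c : ℝ≥0∞, c ≠ 0 ∧ c ≠ ⊤ ∧
    ∀ F : (Fin (n + 1) → ℝ) → ℝ≥0∞, Measurable F →
    ∫⁻ v : KacSphere (n + 1), F (fun i => v.1 i) ∂(unif (n + 1)) =
      c * ∫⁻ y : Fin n → ℝ, sqDensity (fun z => F (append y z)) (((n + 1 : ℕ) : ℝ) - ∑ i, y i ^ 2) := by
  obtain ⟨c₁, hc₁⟩ := lintegral_unif_eq_ball (n + 1)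
  set N : ℝ := ((n + 1 : ℕ) : ℝ) with hN
  have hN0 : 0 < N := by positivity
  -- The total weight of the shells in the ball, `t` being the squared radius and `√(t / N)` the
  -- scale relative to the target sphere.
  set κ : ℝ≥0∞ := ∫⁻ t in Set.Ioo (0 : ℝ) 1,
    ENNReal.ofReal (√(t / N) ^ n) * ENNReal.ofReal (√(t / N))⁻¹ with hκ
  suffices H : ∀ F : (Fin (n + 1) → ℝ) → ℝ≥0∞, Measurable F →
      ∫⁻ v : KacSphere (n + 1), F (fun i => v.1 i) ∂(unif (n + 1)) =
      c₁ * κ * ∫⁻ y : Fin n → ℝ, sqDensity (fun z => F (append y z)) (N - ∑ i, y i ^ 2) by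
    -- The constant is never computed: it is neither `0` nor `⊤` because the case `F = 1` has
    -- integral `1`.
    have := isProbabilityMeasure_unif (N := n + 1) (by omega)
    have h1 := H (fun _ => 1) measurable_const
    rw [lintegral_const, measure_univ, mul_one] at h1
    refine ⟨c₁ * κ, fun h => ?_, fun h => ?_, H⟩
    · rw [h, zero_mul] at h1
      exact one_ne_zero h1
    · rw [h] at h1
      rcases eq_or_ne (∫⁻ y : Fin n → ℝ, sqDensity (fun z => (1 : ℝ≥0∞)) (N - ∑ i, y i ^ 2)) 0
        with h0 | h0
      · rw [h0, mul_zero] at h1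
        exact one_ne_zero h1
      · rw [ENNReal.top_mul h0] at h1
        exact ENNReal.one_ne_top h1
  intro F hF
  set K : (Fin (n + 1) → ℝ) → ℝ≥0∞ := fun x =>
    (Set.Ioo (0 : ℝ) 1).indicator 1 (∑ i, x i ^ 2) * F (radialProj x) with hK
  have hKm : Measurable K :=
    ((measurable_one.indicator measurableSet_Ioo).comp (measurable_sum_sq _)).mul
      (hF.comp measurable_radialProj)
  rw [hc₁ F hF, mul_assoc]
  congr 1
  calc ∫⁻ x, K x = ∫⁻ y : Fin n → ℝ, ∫⁻ z, K (append y z) := lintegral_append hKm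
    -- Trade `z` for the squared radius `t = ∑ y_i² + z²`; after Tonelli, each fixed `t` is an
    -- integral over one sphere.
    _ = ∫⁻ y : Fin n → ℝ, ∫⁻ t, sqDensity (fun z => K (append y z)) (t - ∑ i, y i ^ 2) := by
        refine lintegral_congr fun y => ?_
        have h := lintegral_comp_sq_mul (g := fun z => K (append y z))
          (hKm.comp (measurable_append.comp measurable_prodMk_left))
          (h := fun _ => 1) measurable_const
        simp only [one_mul] at h
        rw [h, lintegral_sub_right_eq_self (fun t => sqDensity (fun z => K (append y z)) t)]
    _ = ∫⁻ t, ∫⁻ y : Fin n → ℝ, sqDensity (fun z => K (append y z)) (t - ∑ i, y i ^ 2) := by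
        refine lintegral_lintegral_swap (Measurable.aemeasurable ?_)
        exact measurable_sqDensity_append hKm measurable_fst (measurable_snd.sub ((measurable_sum_sq n).comp measurable_fst))
    _ = ∫⁻ t in Set.Ioo (0 : ℝ) 1,
          (ENNReal.ofReal (√(t / N) ^ n) * ENNReal.ofReal (√(t / N))⁻¹) *
          ∫⁻ y : Fin n → ℝ, sqDensity (fun z => F (append y z)) (N - ∑ i, y i ^ 2) := by
        rw [← lintegral_indicator measurableSet_Ioo]
        refine lintegral_congr fun t => ?_
        have hval : ∀ (y : Fin n → ℝ) (z : ℝ), ∑ i, y i ^ 2 + z ^ 2 = t →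
            K (append y z) = (Set.Ioo (0 : ℝ) 1).indicator 1 t * F ((√N / √t) • append y z) := by
          intro y z h
          rw [← h, ← sum_sq_append]
          rfl
        have hsqval : ∀ y : Fin n → ℝ, sqDensity (fun z => K (append y z)) (t - ∑ i, y i ^ 2) =
            (Set.Ioo (0 : ℝ) 1).indicator 1 t *
              sqDensity (fun z => F ((√N / √t) • append y z)) (t - ∑ i, y i ^ 2) := by
          intro y
          unfold sqDensity
          by_cases hw : t - ∑ i, y i ^ 2 ∈ Set.Ioi (0 : ℝ)
          · rw [Set.indicator_of_mem hw, Set.indicator_of_mem hw]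
            beta_reduce
            rw [hval y _ (by rw [Real.sq_sqrt (le_of_lt hw)]; ring),
              hval y _ (by rw [neg_sq, Real.sq_sqrt (le_of_lt hw)]; ring)]
            ring
          · rw [Set.indicator_of_notMem hw, Set.indicator_of_notMem hw, mul_zero]
        simp only [hsqval]
        by_cases ht : t ∈ Set.Ioo (0 : ℝ) 1
        · rw [Set.indicator_of_mem ht, Set.indicator_of_mem ht]
          simp only [Pi.one_apply, one_mul]
          have ha0 : 0 < √(t / N) := Real.sqrt_pos.2 (div_pos ht.1 hN0)
          have ht' : t = √(t / N) ^ 2 * N := by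
            rw [Real.sq_sqrt (div_pos ht.1 hN0).le, div_mul_cancel₀ _ hN0.ne']
          have hainv : √N / √t = (√(t / N))⁻¹ := by
            rw [Real.sqrt_div ht.1.le, inv_div]
          rw [hainv, ← lintegral_slice_scale hF ha0, ← ht']
        · rw [Set.indicator_of_notMem ht, Set.indicator_of_notMem ht]
          simp
    _ = _ := by
        rw [lintegral_mul_const _ (by fun_prop)]

/-! ### Integrals against `f^{⊗N} σ^N` in slicing coordinates. -/

lemma lintegral_tensorPower_add (μ : Measure ℝ) [SigmaFinite μ] {k m : ℕ}
    {K : (Fin (k + m) → ℝ) → ℝ≥0∞} (hK : Measurable K) :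
    ∫⁻ x, K x ∂(tensorPower μ (k + m)) =
      ∫⁻ x, ∫⁻ y, K (Fin.append x y) ∂(tensorPower μ m) ∂(tensorPower μ k) := by
  have h := (measurePreserving_piCongrLeft (α := fun _ : Fin (k + m) => ℝ) (fun _ => μ)
    finSumFinEquiv).comp (measurePreserving_sumPiEquivProdPi_symm (fun _ : Fin k ⊕ Fin m => μ))
  rw [tensorPower, ← h.lintegral_comp hK, lintegral_prod _ (by
    exact (hK.comp h.measurable).aemeasurable)]
  refine lintegral_congr fun x => lintegral_congr fun y => ?_
  congr 1
  ext i
  refine Fin.addCases (fun j => ?_) (fun j => ?_) i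
  · rw [Fin.append_left, Function.comp_apply, MeasurableEquiv.coe_piCongrLeft,
      ← finSumFinEquiv_apply_left, Equiv.piCongrLeft_apply_apply]
    rfl
  · rw [Fin.append_right, Function.comp_apply, MeasurableEquiv.coe_piCongrLeft,
      ← finSumFinEquiv_apply_right, Equiv.piCongrLeft_apply_apply]
    rfl

lemma lintegral_tensorPower_density {f : ℝ → ℝ} (hf : IsKacDensity f) {n : ℕ}
    {K : (Fin n → ℝ) → ℝ≥0∞} (hK : Measurable K) :
    ∫⁻ y, K y ∂(tensorPower (density f) n) = ∫⁻ y, K y * ∏ i, ENNReal.ofReal (f (y i)) := by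
  have := hf.isProbabilityMeasure
  have hg := hf.measurable_ofReal
  induction n with
  | zero =>
    rw [tensorPower, volume_pi, Measure.pi_of_empty, Measure.pi_of_empty]
    simp
  | succ n ih =>
    have hKa : Measurable (fun p : (Fin n → ℝ) × ℝ => K (append p.1 p.2)) :=
      hK.comp measurable_append
    have hprod : Measurable (fun y : Fin (n + 1) → ℝ => ∏ i, ENNReal.ofReal (f (y i))) :=
      Finset.measurable_prod _ fun i _ => hg.comp (measurable_pi_apply i)
    rw [lintegral_tensorPower_succ _ hK, ih (Measurable.lintegral_prod_right' hKa),
      lintegral_append (K := fun y => K y * ∏ i, ENNReal.ofReal (f (y i))) (hK.mul hprod)]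
    refine lintegral_congr fun y => ?_
    have hKy : Measurable fun z => K (append y z) := hKa.comp measurable_prodMk_left
    rw [density, lintegral_withDensity_eq_lintegral_mul _ hg hKy, ← lintegral_mul_const _ (by
      exact hg.mul hKy)]
    refine lintegral_congr fun z => ?_
    simp only [Pi.mul_apply]
    rw [Fin.prod_univ_castSucc]
    simp only [append_castSucc, append_last]
    ring

/-- The constant relating the uniform measure on the sphere to the slicing coordinates. -/
def sliceConst (n : ℕ) : ℝ≥0∞ := (lintegral_unif_eq_slice n).choose

lemma sliceConst_ne_zero (n : ℕ) : sliceConst n ≠ 0 := (lintegral_unif_eq_slice n).choose_spec.1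

lemma sliceConst_ne_top (n : ℕ) : sliceConst n ≠ ⊤ := (lintegral_unif_eq_slice n).choose_spec.2.1

lemma lintegral_unif (n : ℕ) {F : (Fin (n + 1) → ℝ) → ℝ≥0∞} (hF : Measurable F) :
    ∫⁻ v : KacSphere (n + 1), F (fun i => v.1 i) ∂(unif (n + 1)) =
      sliceConst n * ∫⁻ y : Fin n → ℝ, sqDensity (fun z => F (append y z))
        (((n + 1 : ℕ) : ℝ) - ∑ i, y i ^ 2) :=
  (lintegral_unif_eq_slice n).choose_spec.2.2 F hF

lemma sqDensity_const_mul (a : ℝ≥0∞) (g : ℝ → ℝ≥0∞) (w : ℝ) :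
    sqDensity (fun z => a * g z) w = a * sqDensity g w := by
  unfold sqDensity
  by_cases hw : w ∈ Set.Ioi (0 : ℝ)
  · rw [Set.indicator_of_mem hw, Set.indicator_of_mem hw]; ring
  · rw [Set.indicator_of_notMem hw, Set.indicator_of_notMem hw, mul_zero]

/-- Integrals of functions of the first `k` coordinates against `f^{⊗N} σ^N`. -/
lemma lintegral_unif_mul_prod {f : ℝ → ℝ} (hf : IsKacDensity f) {k m : ℕ}
    {G : (Fin k → ℝ) → ℝ≥0∞} (hG : Measurable G) :
    ∫⁻ v : KacSphere (k + m + 1), G (fun i => v.1 (Fin.castLE (by omega) i)) *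
        ∏ j, ENNReal.ofReal (f (v.1 j)) ∂(unif (k + m + 1)) =
      sliceConst (k + m) * ∫⁻ x, G x * sumSqDensity f m (((k + m + 1 : ℕ) : ℝ) - ∑ i, x i ^ 2)
        ∂(tensorPower (density f) k) := by
  have := hf.isProbabilityMeasure
  have hg := hf.measurable_ofReal
  have hsq := measurable_sqDensity hg
  have hG' : Measurable fun x : Fin (k + m + 1) → ℝ => G (fun i => x (Fin.castLE (by omega) i)) :=
    hG.comp (by fun_prop)
  have hprod : Measurable (fun y : Fin (k + m + 1) → ℝ => ∏ i, ENNReal.ofReal (f (y i))) :=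
    Finset.measurable_prod _ fun i _ => hg.comp (measurable_pi_apply i)
  rw [lintegral_unif (k + m) (F := fun x => G (fun i => x (Fin.castLE (by omega) i)) *
    ∏ j, ENNReal.ofReal (f (x j))) (hG'.mul hprod)]
  congr 1
  set N : ℝ := ((k + m + 1 : ℕ) : ℝ)
  have hG'' : Measurable fun y : Fin (k + m) → ℝ => G (fun i => y (Fin.castAdd m i)) :=
    hG.comp (by fun_prop)
  have hK : Measurable fun y : Fin (k + m) → ℝ => G (fun i => y (Fin.castAdd m i)) *
      sqDensity (fun v => ENNReal.ofReal (f v)) (N - ∑ i, y i ^ 2) :=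
    hG''.mul (hsq.comp (measurable_const.sub (measurable_sum_sq _)))
  calc _ = ∫⁻ y : Fin (k + m) → ℝ, (G (fun i => y (Fin.castAdd m i)) *
        sqDensity (fun v => ENNReal.ofReal (f v)) (N - ∑ i, y i ^ 2)) *
          ∏ i, ENNReal.ofReal (f (y i)) := by
        refine lintegral_congr fun y => ?_
        have : ∀ z, G (fun i => append y z (Fin.castLE (by omega) i)) *
            ∏ j, ENNReal.ofReal (f (append y z j)) =
            (G (fun i => y (Fin.castAdd m i)) * ∏ i, ENNReal.ofReal (f (y i))) *
              ENNReal.ofReal (f z) := by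
          intro z
          rw [Fin.prod_univ_castSucc]
          simp only [append_castSucc, append_last]
          rw [mul_assoc]
          congr 2
          ext i
          exact append_castSucc y z (Fin.castAdd m i)
        simp only [this]
        rw [sqDensity_const_mul]
        ring
    _ = ∫⁻ y : Fin (k + m) → ℝ, G (fun i => y (Fin.castAdd m i)) *
        sqDensity (fun v => ENNReal.ofReal (f v)) (N - ∑ i, y i ^ 2)
          ∂(tensorPower (density f) (k + m)) := (lintegral_tensorPower_density hf hK).symm
    _ = _ := by
        rw [lintegral_tensorPower_add _ hK]
        refine lintegral_congr fun x => ?_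
        simp only [Fin.append_left]
        rw [lintegral_const_mul]
        · congr 1
          rw [sumSqDensity]
          refine lintegral_congr fun y => ?_
          rw [Fin.sum_univ_add]
          simp only [Fin.append_left, Fin.append_right]
          rw [sub_sub]
        · refine hsq.comp (measurable_const.sub ?_)
          simp only [Fin.sum_univ_add, Fin.append_left, Fin.append_right]
          exact measurable_const.add (measurable_sum_sq m)

/-- The case of no observed coordinates, `k = 0` and `G = 1`. -/
lemma Z_eq {f : ℝ → ℝ} (hf : IsKacDensity f) (n : ℕ) :
    Z f (n + 1) = sliceConst n * sumSqDensity f n ((n : ℝ) + 1) := by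
  have := hf.isProbabilityMeasure
  have h := lintegral_unif_mul_prod hf (k := 0) (m := n) (G := fun _ => 1) measurable_const
  simp only [Nat.zero_add, one_mul] at h
  have h' : Z f (0 + n + 1) = _ := h
  have e : ∀ j : ℕ, j = n → Z f (j + 1) = Z f (n + 1) := by rintro j rfl; rfl
  rw [e _ (Nat.zero_add n)] at h'
  rw [h']
  simp

/-! ### The conditioned product and its marginals. -/

section

variable {f : ℝ → ℝ}

lemma sumSqDensity_ne_top (hf : IsKacDensity f) {m : ℕ} (hm : 4 ≤ m) (r : ℝ) :
    sumSqDensity f m r ≠ ⊤ := by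
  obtain ⟨L, hL, hlim, C, hC, hbd⟩ := sumSqDensity_asymptotics hf
  intro h
  have := hbd m hm r
  rw [h, ENNReal.mul_top (by simp; omega)] at this
  exact absurd this (by simp)

/-- Quantitative form of the local limit bounds, uniformly for large `n`. -/
lemma exists_sumSqDensity_bounds (hf : IsKacDensity f) :
    ∃ a > 0, ∃ C > 0, ∃ n₀ : ℕ, 4 ≤ n₀ ∧
      (∀ n, n₀ ≤ n → a ≤ √n * (sumSqDensity f n ((n : ℝ) + 1)).toReal) ∧
      ∀ m : ℕ, 4 ≤ m → ∀ r, √m * (sumSqDensity f m r).toReal ≤ C := by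
  obtain ⟨L, hL, hlim, C, hC, hbd⟩ := sumSqDensity_asymptotics hf
  obtain ⟨n₀, hn₀⟩ := eventually_atTop.1 ((hlim 1).eventually_const_le (half_lt_self hL))
  refine ⟨L / 2, by positivity, C, hC, max n₀ 4, le_max_right _ _,
    fun n hn => hn₀ n ((le_max_left _ _).trans hn), fun m hm r => ?_⟩
  have := ENNReal.toReal_mono ENNReal.ofReal_ne_top (hbd m hm r)
  rwa [ENNReal.toReal_mul, ENNReal.toReal_ofReal (Real.sqrt_nonneg _),
    ENNReal.toReal_ofReal hC.le] at this

lemma exists_Z_pos_lt_top (hf : IsKacDensity f) :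
    ∃ N₀ : ℕ, 5 ≤ N₀ ∧ ∀ N, N₀ ≤ N → 0 < Z f N ∧ Z f N < ⊤ := by
  obtain ⟨a, ha, C, hC, n₀, hn₀, hlow, hup⟩ := exists_sumSqDensity_bounds hf
  refine ⟨n₀ + 1, by omega, fun N hN => ?_⟩
  obtain ⟨n, rfl⟩ : ∃ n, N = n + 1 := ⟨N - 1, by omega⟩
  have hn : n₀ ≤ n := by omega
  rw [Z_eq hf]
  have hne : sumSqDensity f n ((n : ℝ) + 1) ≠ 0 := by
    intro h
    have := hlow n hn
    rw [h] at this
    simp at this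
    linarith
  exact ⟨ENNReal.mul_pos (sliceConst_ne_zero n) hne,
    ENNReal.mul_lt_top (sliceConst_ne_top n).lt_top (sumSqDensity_ne_top hf (by omega) _).lt_top⟩

lemma measurable_coord {N : ℕ} (j : Fin N) : Measurable fun v : KacSphere N => v.1 j :=
  ((measurable_pi_apply j).comp (WithLp.measurable_ofLp 2 _)).comp measurable_subtype_coe

lemma measurable_coords {N : ℕ} {ι : Type*} (e : ι → Fin N) :
    Measurable fun (v : KacSphere N) (i : ι) => v.1 (e i) :=
  measurable_pi_iff.2 fun i => measurable_coord (e i)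

lemma measurable_prod_coord (hf : IsKacDensity f) (N : ℕ) :
    Measurable fun v : KacSphere N => ∏ j, ENNReal.ofReal (f (v.1 j)) :=
  Finset.measurable_prod _ fun j _ => hf.measurable_ofReal.comp (measurable_coord j)

lemma lintegral_condProd (hf : IsKacDensity f) {N : ℕ} {F : KacSphere N → ℝ≥0∞}
    (hF : Measurable F) :
    ∫⁻ v, F v ∂(condProd f N) =
      (∫⁻ v, F v * ∏ j, ENNReal.ofReal (f (v.1 j)) ∂(unif N)) * (Z f N)⁻¹ := by
  have hp := measurable_prod_coord hf N
  rw [condProd, lintegral_withDensity_eq_lintegral_mul _ (by fun_prop) hF,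
    ← lintegral_mul_const _ (by fun_prop)]
  refine lintegral_congr fun v => ?_
  simp only [Pi.mul_apply, div_eq_mul_inv]
  ring

lemma isProbabilityMeasure_condProd {f : ℝ → ℝ} {N : ℕ} (h : 0 < Z f N ∧ Z f N < ⊤) :
    IsProbabilityMeasure (condProd f N) := by
  constructor
  rw [condProd, withDensity_apply _ MeasurableSet.univ, setLIntegral_univ]
  simp only [div_eq_mul_inv]
  rw [lintegral_mul_const' _ _ (ENNReal.inv_ne_top.2 h.1.ne')]
  exact ENNReal.mul_inv_cancel h.1.ne' h.2.ne

lemma isSymm_condProd (hf : IsKacDensity f) (N : ℕ) : IsSymm (condProd f N) := by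
  intro τ
  have hp : Measurable fun x : Fin N → ℝ => ∏ j, ENNReal.ofReal (f (x j)) :=
    Finset.measurable_prod _ fun j _ => hf.measurable_ofReal.comp (measurable_pi_apply j)
  refine Measure.ext_of_lintegral _ fun (F : (Fin N → ℝ) → ℝ≥0∞) hF => ?_
  have h1 : Measurable fun v : KacSphere N => F fun i => v.1 (τ i) := hF.comp (measurable_coords _)
  have h2 : Measurable fun v : KacSphere N => F fun i => v.1 i := hF.comp (measurable_coords _)
  rw [lintegral_map hF (measurable_coords _), lintegral_map hF (measurable_coords _),
    lintegral_condProd hf h1, lintegral_condProd hf h2,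
    ← lintegral_unif_comp_perm τ (F := fun x => F x * ∏ j, ENNReal.ofReal (f (x j))) (hF.mul hp)]
  congr 1
  refine lintegral_congr fun v => ?_
  congr 1
  exact (Equiv.prod_comp τ (fun j => ENNReal.ofReal (f (v.1 j)))).symm

/-- Integrals of functions of the first `k` coordinates against the conditioned product. -/
lemma lintegral_condProd_first (hf : IsKacDensity f) {k m : ℕ}
    {G : (Fin k → ℝ) → ℝ≥0∞} (hG : Measurable G) :
    ∫⁻ v : KacSphere (k + m + 1), G (fun i => v.1 (Fin.castLE (by omega) i))
        ∂(condProd f (k + m + 1)) =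
      ∫⁻ x, G x * (sumSqDensity f m (((k + m + 1 : ℕ) : ℝ) - ∑ i, x i ^ 2) /
        sumSqDensity f (k + m) (((k + m : ℕ) : ℝ) + 1)) ∂(tensorPower (density f) k) := by
  have hm := measurable_sumSqDensity hf m
  have hs : Measurable fun x : Fin k → ℝ =>
      sumSqDensity f m (((k + m + 1 : ℕ) : ℝ) - ∑ i, x i ^ 2) :=
    hm.comp (measurable_const.sub (measurable_sum_sq k))
  have hG' : Measurable fun v : KacSphere (k + m + 1) =>
      G (fun i => v.1 (Fin.castLE (by omega) i)) := hG.comp (measurable_coords _)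
  rw [lintegral_condProd hf hG', lintegral_unif_mul_prod hf hG, Z_eq hf,
    ENNReal.mul_inv (Or.inl (sliceConst_ne_zero _)) (Or.inl (sliceConst_ne_top _)),
    mul_mul_mul_comm,
    ENNReal.mul_inv_cancel (sliceConst_ne_zero _) (sliceConst_ne_top _), one_mul,
    ← lintegral_mul_const _ (by fun_prop)]
  refine lintegral_congr fun x => ?_
  rw [mul_assoc, div_eq_mul_inv]

/-- The marginal of the conditioned product is dominated by the product, up to a factor `O(√N)`. -/
lemma exists_lintegral_condProd_le (hf : IsKacDensity f) : ∃ C > 0, ∃ N₀ : ℕ, ∀ N, N₀ ≤ N →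
    ∀ (k : ℕ) (hk : k + 5 ≤ N) (G : (Fin k → ℝ) → ℝ≥0∞), Measurable G →
      ∫⁻ v : KacSphere N, G (fun i => v.1 (Fin.castLE (by omega) i)) ∂(condProd f N) ≤
        ENNReal.ofReal (C * √N) * ∫⁻ x, G x ∂(tensorPower (density f) k) := by
  obtain ⟨a, ha, C, hC, n₀, hn₀, hlow, hup⟩ := exists_sumSqDensity_bounds hf
  refine ⟨C / a, by positivity, n₀ + 1, fun N hN k hk G hG => ?_⟩
  obtain ⟨m, rfl⟩ : ∃ m, N = k + m + 1 := ⟨N - 1 - k, by omega⟩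
  rw [lintegral_condProd_first hf hG, mul_comm, ← lintegral_mul_const' _ _ ENNReal.ofReal_ne_top]
  refine lintegral_mono fun x => ?_
  gcongr
  set r := (((k + m + 1 : ℕ) : ℝ) - ∑ i, x i ^ 2)
  have hm4 : 4 ≤ m := by omega
  have h1 := hup m hm4 r
  have h2 := hlow (k + m) (by omega)
  set q := (sumSqDensity f m r).toReal with hq
  set p := (sumSqDensity f (k + m) (((k + m : ℕ) : ℝ) + 1)).toReal with hp
  have hs : 0 < √((k + m : ℕ) : ℝ) := Real.sqrt_pos.2 (by positivity)
  have hppos : 0 < p := by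
    by_contra h
    have : √((k + m : ℕ) : ℝ) * p ≤ 0 := mul_nonpos_of_nonneg_of_nonpos hs.le (not_lt.1 h)
    linarith
  have hq0 : 0 ≤ q := ENNReal.toReal_nonneg
  -- As few as `m + 1 = 5` coordinates may remain unobserved, so the numerator is only bounded by a
  -- constant, while the denominator is at least of order `1/√N`; hence the factor `√N`.
  have hqC : q ≤ C := by
    have : 1 ≤ √(m : ℝ) := Real.one_le_sqrt.2 (by exact_mod_cast (by omega : 1 ≤ m))
    nlinarith
  have hsN : √((k + m : ℕ) : ℝ) ≤ √((k + m + 1 : ℕ) : ℝ) :=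
    Real.sqrt_le_sqrt (by push_cast; linarith)
  rw [← ENNReal.ofReal_toReal (sumSqDensity_ne_top hf hm4 r),
    ← ENNReal.ofReal_toReal (sumSqDensity_ne_top hf (by omega : 4 ≤ k + m) _),
    ← hq, ← hp, ← ENNReal.ofReal_div_of_pos hppos]
  refine ENNReal.ofReal_le_ofReal ?_
  rw [div_le_iff₀ hppos]
  calc q ≤ C := hqC
    _ = C / a * a := by field_simp
    _ ≤ C / a * (√((k + m + 1 : ℕ) : ℝ) * p) := by gcongr; nlinarith
    _ = _ := by ring

lemma klFun_le_sq {x : ℝ} (hx : 0 ≤ x) : InformationTheory.klFun x ≤ (x - 1) ^ 2 := by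
  rw [InformationTheory.klFun_apply]
  rcases hx.eq_or_lt with rfl | hx
  · simp
  · nlinarith [Real.log_le_sub_one_of_pos hx]

lemma marginal_condProd (hf : IsKacDensity f) (k m : ℕ) :
    marginal k (condProd f (k + m + 1)) = (tensorPower (density f) k).withDensity fun x =>
      sumSqDensity f m (((k + m + 1 : ℕ) : ℝ) - ∑ i, x i ^ 2) /
        sumSqDensity f (k + m) (((k + m : ℕ) : ℝ) + 1) := by
  have hk : k ≤ k + m + 1 := by omega
  have hm := measurable_sumSqDensity hf m
  have hs : Measurable fun x : Fin k → ℝ =>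
      sumSqDensity f m (((k + m + 1 : ℕ) : ℝ) - ∑ i, x i ^ 2) /
        sumSqDensity f (k + m) (((k + m : ℕ) : ℝ) + 1) :=
    (hm.comp (measurable_const.sub (measurable_sum_sq k))).div_const _
  rw [marginal, dif_pos hk]
  refine Measure.ext_of_lintegral _ fun G hG => ?_
  rw [lintegral_map hG (measurable_coords _), lintegral_condProd_first hf hG,
    lintegral_withDensity_eq_lintegral_mul _ hs hG]
  simp only [Pi.mul_apply, mul_comm]

/-- The `k`-marginals of the conditioned product converge to the product in relative entropy. -/
theorem tendsto_klDiv_marginal_condProd (hf : IsKacDensity f) (k : ℕ) :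
    Tendsto (fun N : ℕ => InformationTheory.klDiv (marginal k (condProd f N))
      (tensorPower (density f) k)) atTop (𝓝 0) := by
  have := hf.isProbabilityMeasure
  obtain ⟨L, hL, hlim, -⟩ := sumSqDensity_asymptotics hf
  obtain ⟨a, ha, C, hC, n₀, hn₀, hlow, hup⟩ := exists_sumSqDensity_bounds hf
  obtain ⟨N₀, hN₀, hZ⟩ := exists_Z_pos_lt_top hf
  set ρ : ℕ → (Fin k → ℝ) → ℝ≥0∞ := fun m x =>
    sumSqDensity f m (((k + m + 1 : ℕ) : ℝ) - ∑ i, x i ^ 2) /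
      sumSqDensity f (k + m) (((k + m : ℕ) : ℝ) + 1) with hρ
  have hρm : ∀ m, Measurable (ρ m) := fun m =>
    ((measurable_sumSqDensity hf m).comp
      (measurable_const.sub (measurable_sum_sq k))).div_const _
  have hkl : ∀ m, N₀ ≤ k + m + 1 → InformationTheory.klDiv (marginal k (condProd f (k + m + 1)))
      (tensorPower (density f) k) = ∫⁻ x, ENNReal.ofReal (InformationTheory.klFun (ρ m x).toReal)
        ∂(tensorPower (density f) k) := by
    intro m hm
    have hp := isProbabilityMeasure_condProd (hZ _ hm)
    have hk : k ≤ k + m + 1 := by omega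
    have : IsProbabilityMeasure (marginal k (condProd f (k + m + 1))) := by
      rw [marginal, dif_pos hk]
      exact Measure.isProbabilityMeasure_map (measurable_coords _).aemeasurable
    have heq := marginal_condProd hf k m
    have hac : marginal k (condProd f (k + m + 1)) ≪ tensorPower (density f) k := by
      rw [heq]; exact withDensity_absolutelyContinuous _ _
    rw [InformationTheory.klDiv_eq_lintegral_klFun_of_ac hac]
    refine lintegral_congr_ae ?_
    have hrn : (marginal k (condProd f (k + m + 1))).rnDeriv (tensorPower (density f) k)
        =ᵐ[tensorPower (density f) k] ρ m := by
      rw [heq]; exact Measure.rnDeriv_withDensity _ (hρm m)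
    filter_upwards [hrn] with x hx
    rw [hx]
  rw [← tendsto_add_atTop_iff_nat (k + 1)]
  have hcong : (fun m : ℕ => ∫⁻ x, ENNReal.ofReal (InformationTheory.klFun (ρ m x).toReal)
      ∂(tensorPower (density f) k)) =ᶠ[atTop] fun m : ℕ =>
      InformationTheory.klDiv (marginal k (condProd f (m + (k + 1))))
        (tensorPower (density f) k) := by
    filter_upwards [eventually_ge_atTop N₀] with m hm
    rw [← hkl m (by omega), show m + (k + 1) = k + m + 1 by omega]
  refine Tendsto.congr' hcong ?_
  have hratio : Tendsto (fun m : ℕ => √((k + m : ℕ) : ℝ) / √(m : ℝ)) atTop (𝓝 1) := by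
    have h1 : Tendsto (fun m : ℕ => √((k : ℝ) / m + 1)) atTop (𝓝 √(0 + 1)) :=
      (((tendsto_const_div_atTop_nhds_zero_nat (k : ℝ))).add_const 1).sqrt
    rw [zero_add, Real.sqrt_one] at h1
    refine h1.congr' ?_
    filter_upwards [eventually_gt_atTop 0] with m hm
    have : (0 : ℝ) < m := by exact_mod_cast hm
    rw [← Real.sqrt_div (by positivity)]
    congr 1
    push_cast
    field_simp
  -- Normalized by the square roots of their own indices, numerator and denominator both tend to the
  -- same `L`, and the ratio of those roots tends to `1`.
  have hρreal : ∀ m x, 0 < m → (ρ m x).toReal = (√m * (sumSqDensity f m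
      (m + ((k : ℝ) + 1 - ∑ i, x i ^ 2))).toReal) /
      (√((k + m : ℕ) : ℝ) * (sumSqDensity f (k + m) (((k + m : ℕ) : ℝ) + 1)).toReal) *
        (√((k + m : ℕ) : ℝ) / √(m : ℝ)) := by
    intro m x hm
    have h1 : √(m : ℝ) ≠ 0 := by positivity
    have h2 : √((k + m : ℕ) : ℝ) ≠ 0 := by positivity
    rw [hρ]
    simp only [ENNReal.toReal_div]
    rw [show ((k + m + 1 : ℕ) : ℝ) - ∑ i, x i ^ 2 = m + ((k : ℝ) + 1 - ∑ i, x i ^ 2) by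
      push_cast; ring]
    field_simp
  have hρlim : ∀ x, Tendsto (fun m => (ρ m x).toReal) atTop (𝓝 1) := by
    intro x
    have h1 := hlim ((k : ℝ) + 1 - ∑ i, x i ^ 2)
    have h2 := (tendsto_add_atTop_iff_nat k).2 (hlim 1)
    have h2' : Tendsto (fun m : ℕ => √((k + m : ℕ) : ℝ) *
        (sumSqDensity f (k + m) (((k + m : ℕ) : ℝ) + 1)).toReal) atTop (𝓝 L) := by
      refine h2.congr fun m => ?_
      rw [add_comm m k]
    have h3 := (h1.div h2' hL.ne').mul hratio
    rw [div_self hL.ne', one_mul] at h3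
    refine h3.congr' ?_
    filter_upwards [eventually_gt_atTop 0] with m hm
    rw [hρreal m x hm]
    rfl
  have hbound : ∀ᶠ m : ℕ in atTop, ∀ x, (ρ m x).toReal ≤ C / a * 2 := by
    filter_upwards [eventually_ge_atTop n₀, hratio.eventually_le_const (show (1 : ℝ) < 2 by norm_num)]
      with m hm hm2 x
    rw [hρreal m x (by omega)]
    have h1 := hup m (by omega) (m + ((k : ℝ) + 1 - ∑ i, x i ^ 2))
    have h2 := hlow (k + m) (by omega)
    gcongr
  -- The densities are bounded and tend to `1`, where `klFun` vanishes; `klFun_le_sq` supplies the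
  -- dominating constant.
  have hdct : Tendsto (fun m : ℕ => ∫⁻ x, ENNReal.ofReal (InformationTheory.klFun (ρ m x).toReal)
      ∂(tensorPower (density f) k)) atTop (𝓝 (∫⁻ _, 0 ∂(tensorPower (density f) k))) := by
    refine tendsto_lintegral_filter_of_dominated_convergence
      (fun _ => ENNReal.ofReal ((C / a * 2 + 1) ^ 2)) ?_ ?_ (by simp) ?_
    · refine Eventually.of_forall fun m => ?_
      have := hρm m
      have hkm := InformationTheory.measurable_klFun
      fun_prop
    · filter_upwards [hbound] with m hm
      refine ae_of_all _ fun x => ENNReal.ofReal_le_ofReal ?_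
      refine (klFun_le_sq ENNReal.toReal_nonneg).trans ?_
      have h1 := hm x
      have h0 : 0 ≤ (ρ m x).toReal := ENNReal.toReal_nonneg
      have h3 : 0 ≤ C / a * 2 := by positivity
      nlinarith
    · refine ae_of_all _ fun x => ?_
      have := (InformationTheory.continuous_klFun.tendsto 1).comp (hρlim x)
      rw [InformationTheory.klFun_one] at this
      simpa using ENNReal.tendsto_ofReal this
  simpa using hdct

end

/-! ### Entropy inequalities and block averages. -/

section

section Entropy

variable {α : Type*} [MeasurableSpace α] {P Q : Measure α} [IsProbabilityMeasure P]
  [IsProbabilityMeasure Q]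

/-- Young's inequality for the conjugate pair `x log x - x`, `exp y`. -/
lemma mul_le_klFun_add_exp {x : ℝ} (hx : 0 ≤ x) (y : ℝ) :
    x * y ≤ InformationTheory.klFun x + (Real.exp y - 1) := by
  rw [InformationTheory.klFun_apply]
  rcases hx.eq_or_lt with rfl | hx
  · simp
    positivity
  · have h1 := Real.add_one_le_exp (y - Real.log x)
    rw [Real.exp_sub, Real.exp_log hx, le_div_iff₀ hx] at h1
    nlinarith

/-- By Young's inequality, the Radon-Nikodym density times `|G|` is at most `klFun` of the density
plus `exp |G| - 1`, and both are `Q`-integrable. -/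
lemma integrable_of_klDiv_ne_top (h : InformationTheory.klDiv P Q ≠ ⊤) {G : α → ℝ}
    (hG : Measurable G) (hexp : Integrable (fun x => Real.exp |G x|) Q) : Integrable G P := by
  obtain ⟨hac, h_int⟩ := InformationTheory.klDiv_ne_top_iff.1 h
  rw [← integrable_rnDeriv_smul_iff hac]
  have hk : Integrable (fun x => InformationTheory.klFun (P.rnDeriv Q x).toReal) Q :=
    (InformationTheory.integrable_klFun_rnDeriv_iff hac).2 h_int
  refine (hk.add (hexp.sub (integrable_const 1))).mono'
    (by have := P.measurable_rnDeriv Q; fun_prop) (ae_of_all _ fun x => ?_)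
  rw [smul_eq_mul, norm_mul, Real.norm_of_nonneg ENNReal.toReal_nonneg, Real.norm_eq_abs]
  exact mul_le_klFun_add_exp ENNReal.toReal_nonneg _

/-- The **Donsker-Varadhan inequality**. -/
lemma integral_le_klDiv_add_log (h : InformationTheory.klDiv P Q ≠ ⊤) {G : α → ℝ}
    (hG : Integrable G P) (hexp : Integrable (fun x => Real.exp (G x)) Q) :
    ∫ x, G x ∂P ≤ (InformationTheory.klDiv P Q).toReal + Real.log (∫ x, Real.exp (G x) ∂Q) := by
  obtain ⟨hac, h_int⟩ := InformationTheory.klDiv_ne_top_iff.1 h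
  have : IsProbabilityMeasure (Q.tilted G) := isProbabilityMeasure_tilted hexp
  -- The inequality is nonnegativity of the entropy of `P` relative to `Q` tilted by `G`.
  have h1 := InformationTheory.integral_llr_add_sub_measure_univ_nonneg
    (hac.trans (absolutelyContinuous_tilted hexp))
    (integrable_llr_tilted_right hac hG h_int hexp)
  rw [integral_llr_tilted_right hac hG hexp h_int] at h1
  rw [InformationTheory.toReal_klDiv_of_measure_eq hac (by simp)]
  simp only [probReal_univ] at h1
  linarith

end Entropy

lemma lintegral_pi_prod_eq_pow {α : Type*} [MeasurableSpace α] (ν : Measure α) [SigmaFinite ν]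
    {H : α → ℝ≥0∞} (hH : Measurable H) (b : ℕ) :
    ∫⁻ y : Fin b → α, ∏ i, H (y i) ∂(Measure.pi fun _ => ν) = (∫⁻ x, H x ∂ν) ^ b := by
  induction b with
  | zero => rw [Measure.pi_of_empty]; simp
  | succ b ih =>
    have h := (measurePreserving_piFinSuccAbove (fun _ : Fin (b + 1) => ν) 0).symm
    have hm : Measurable fun y : Fin (b + 1) → α => ∏ i, H (y i) :=
      Finset.measurable_prod _ fun i _ => hH.comp (measurable_pi_apply i)
    have hm' : Measurable fun y : Fin b → α => ∏ i, H (y i) :=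
      Finset.measurable_prod _ fun i _ => hH.comp (measurable_pi_apply i)
    rw [← h.lintegral_comp hm]
    have e : ∀ p : α × (Fin b → α), ∏ i, H ((MeasurableEquiv.piFinSuccAbove
        (fun _ : Fin (b + 1) => α) 0).symm p i) = H p.1 * ∏ i, H (p.2 i) := by
      intro p
      rw [Fin.prod_univ_succ]
      rfl
    simp only [e]
    rw [lintegral_prod_mul hH.aemeasurable hm'.aemeasurable, ih, pow_succ']

/-- Grouping `b * k` independent coordinates into `b` blocks of length `k`. -/
lemma measurePreserving_blocks (μ : Measure ℝ) [IsProbabilityMeasure μ] (b k : ℕ) :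
    MeasurePreserving (fun (x : Fin (b * k) → ℝ) (i : Fin b) (j : Fin k) => x (finProdFinEquiv (i, j)))
      (tensorPower μ (b * k)) (Measure.pi fun _ => tensorPower μ k) := by
  have h1 := measurePreserving_piCongrLeft (α := fun _ : Fin b × Fin k => ℝ) (fun _ => μ)
    (finProdFinEquiv (m := b) (n := k)).symm
  have h2 : MeasurePreserving (MeasurableEquiv.curry (Fin b) (Fin k) ℝ)
      (Measure.pi fun _ : Fin b × Fin k => μ) (Measure.pi fun _ => tensorPower μ k) := by
    refine ⟨MeasurableEquiv.measurable _, ?_⟩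
    have := Measure.infinitePi_map_curry (fun (_ : Fin b) (_ : Fin k) => μ)
    simpa only [Measure.infinitePi_eq_pi, tensorPower] using this
  have h3 : (fun (x : Fin (b * k) → ℝ) (i : Fin b) (j : Fin k) => x (finProdFinEquiv (i, j))) =
      MeasurableEquiv.curry (Fin b) (Fin k) ℝ ∘
        MeasurableEquiv.piCongrLeft (fun _ => ℝ) finProdFinEquiv.symm := by
    ext x i j
    rw [Function.comp_apply, MeasurableEquiv.coe_piCongrLeft]
    change _ = (Equiv.piCongrLeft (fun _ => ℝ) finProdFinEquiv.symm x) (i, j)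
    rw [Equiv.piCongrLeft_apply]
    simp
  rw [h3]
  exact h2.comp h1

lemma lintegral_blocks (μ : Measure ℝ) [IsProbabilityMeasure μ] (b k : ℕ)
    {H : (Fin k → ℝ) → ℝ≥0∞} (hH : Measurable H) :
    ∫⁻ x, ∏ i : Fin b, H (fun j => x (finProdFinEquiv (i, j))) ∂(tensorPower μ (b * k)) =
      (∫⁻ x, H x ∂(tensorPower μ k)) ^ b := by
  have hm : Measurable fun y : Fin b → Fin k → ℝ => ∏ i, H (y i) :=
    Finset.measurable_prod _ fun i _ => hH.comp (measurable_pi_apply i)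
  rw [← lintegral_pi_prod_eq_pow _ hH, ← (measurePreserving_blocks μ b k).lintegral_comp hm]

/-- The symmetric group acts transitively on injections of `Fin k` into `Fin N`, so any `k` distinct
coordinates have the law of the first `k`. -/
lemma map_coords_eq_marginal {N k : ℕ} {P : Measure (KacSphere N)} (hP : IsSymm P) (hk : k ≤ N)
    {e : Fin k → Fin N} (he : Function.Injective e) :
    P.map (fun v j => v.1 (e j)) = marginal k P := by
  have := Equiv.Perm.isMultiplyPretransitive (Fin N) k
  obtain ⟨τ, hτ⟩ := MulAction.exists_smul_eq (Equiv.Perm (Fin N))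
    (⟨Fin.castLE hk, Fin.castLE_injective hk⟩ : Fin k ↪ Fin N) ⟨e, he⟩
  have hτ' : ∀ j, τ (Fin.castLE hk j) = e j := fun j => DFunLike.congr_fun hτ j
  have h := congrArg (Measure.map fun (x : Fin N → ℝ) (j : Fin k) => x (Fin.castLE hk j)) (hP τ)
  rw [Measure.map_map (by fun_prop) (measurable_coords _),
    Measure.map_map (by fun_prop) (measurable_coords _)] at h
  rw [marginal, dif_pos hk]
  simpa only [Function.comp_def, hτ'] using h

lemma integrable_exp_of_integrable_exp_abs {α : Type*} [MeasurableSpace α] {P : Measure α}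
    {φ : α → ℝ} (hφ : Measurable φ) {l : ℝ} (hexp : Integrable (fun x => Real.exp (l * |φ x|)) P)
    {t : ℝ} (ht : |t| ≤ l) : Integrable (fun x => Real.exp (t * φ x)) P := by
  refine hexp.mono' (by fun_prop) (ae_of_all _ fun x => ?_)
  rw [Real.norm_of_nonneg (Real.exp_pos _).le]
  refine Real.exp_le_exp.2 ((le_abs_self _).trans ?_)
  rw [abs_mul]
  gcongr

/-- The slope of the cumulant generating function at `0` is the mean. -/
lemma exists_cgf_div_lt {α : Type*} [MeasurableSpace α] {P : Measure α} [IsProbabilityMeasure P]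
    {φ : α → ℝ} (hφ : Measurable φ) {l : ℝ} (hl : 0 < l)
    (hexp : Integrable (fun x => Real.exp (l * |φ x|)) P) {a : ℝ} (ha : ∫ x, φ x ∂P < a) :
    ∃ t, 0 < t ∧ t ≤ l ∧ cgf φ P t / t < a := by
  have hmem : (0 : ℝ) ∈ interior (integrableExpSet φ P) := by
    rw [mem_interior_iff_mem_nhds]
    filter_upwards [Ioo_mem_nhds (neg_lt_zero.2 hl) hl] with t ht
    exact integrable_exp_of_integrable_exp_abs hφ hexp (abs_le.2 ⟨ht.1.le, ht.2.le⟩)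
  have hd : HasDerivAt (cgf φ P) (∫ x, φ x ∂P) 0 := by
    have h1 := (analyticAt_cgf hmem).differentiableAt.hasDerivAt
    rw [deriv_cgf_zero hmem] at h1
    simpa using h1
  have h2 := (hasDerivAt_iff_tendsto_slope_zero.1 hd).mono_left
    (nhdsWithin_mono 0 (fun x hx => ne_of_gt hx : Set.Ioi (0 : ℝ) ⊆ {0}ᶜ))
  have h3 := (h2.eventually_lt_const ha).and
    (Ioc_mem_nhdsGT hl : Set.Ioc 0 l ∈ 𝓝[>] (0 : ℝ))
  obtain ⟨t, ht, ht'⟩ := h3.exists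
  refine ⟨t, ht'.1, ht'.2, ?_⟩
  simpa [div_eq_inv_mul] using ht

variable {f : ℝ → ℝ}

/-- Domination carries the exponential moment from the product to the conditioned product, and
finite entropy then gives integrability under `P`. -/
lemma integrable_comp_first_of_klDiv_ne_top {C : ℝ} {N k : ℕ}
    (hk : k ≤ N) {P : Measure (KacSphere N)}
    [IsProbabilityMeasure P] [IsProbabilityMeasure (condProd f N)]
    (hle : ∀ G : (Fin k → ℝ) → ℝ≥0∞, Measurable G →
      ∫⁻ v : KacSphere N, G (fun i => v.1 (Fin.castLE hk i)) ∂(condProd f N) ≤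
        ENNReal.ofReal C * ∫⁻ x, G x ∂(tensorPower (density f) k))
    (hkl : InformationTheory.klDiv P (condProd f N) ≠ ⊤)
    {φ : (Fin k → ℝ) → ℝ} (hφ : Measurable φ) {l : ℝ} (hl : 0 < l)
    (hexp : Integrable (fun x => Real.exp (l * |φ x|)) (tensorPower (density f) k)) :
    Integrable φ (marginal k P) := by
  have hφv : Measurable fun v : KacSphere N => φ (fun i => v.1 (Fin.castLE hk i)) :=
    hφ.comp (measurable_coords _)
  rw [marginal, dif_pos hk, integrable_map_measure hφ.aestronglyMeasurable
    (measurable_coords _).aemeasurable, Function.comp_def]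
  have hi : Integrable (fun v : KacSphere N => l * φ (fun i => v.1 (Fin.castLE hk i))) P := by
    refine integrable_of_klDiv_ne_top hkl (by fun_prop)
      ⟨Measurable.aestronglyMeasurable (by fun_prop), ?_⟩
    rw [hasFiniteIntegral_iff_ofReal (ae_of_all _ fun _ => (Real.exp_pos _).le)]
    refine lt_of_le_of_lt (hle (fun x => ENNReal.ofReal (Real.exp |l * φ x|)) (by fun_prop)) ?_
    refine ENNReal.mul_lt_top ENNReal.ofReal_lt_top ?_
    simp only [abs_mul, abs_of_pos hl]
    exact (hasFiniteIntegral_iff_ofReal (ae_of_all _ fun _ => (Real.exp_pos _).le)).1 hexp.2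
  have := hi.const_mul l⁻¹
  simpa only [inv_mul_cancel_left₀ hl.ne'] using this

/-- The entropy bound for block averages. -/
lemma mul_integral_marginal_le (hf : IsKacDensity f) {C : ℝ} (hC : 0 < C) {N k b : ℕ}
    (hk : k ≤ N) (hbk : b * k ≤ N) {P : Measure (KacSphere N)}
    [IsProbabilityMeasure P] [IsProbabilityMeasure (condProd f N)] (hP : IsSymm P)
    (hle : ∀ G : (Fin (b * k) → ℝ) → ℝ≥0∞, Measurable G →
      ∫⁻ v : KacSphere N, G (fun i => v.1 (Fin.castLE hbk i)) ∂(condProd f N) ≤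
        ENNReal.ofReal C * ∫⁻ x, G x ∂(tensorPower (density f) (b * k)))
    (hkl : InformationTheory.klDiv P (condProd f N) ≠ ⊤)
    {φ : (Fin k → ℝ) → ℝ} (hφ : Measurable φ) (hφi : Integrable φ (marginal k P)) {t : ℝ}
    (hexp : Integrable (fun x => Real.exp (t * φ x)) (tensorPower (density f) k)) :
    b * (t * ∫ x, φ x ∂(marginal k P)) ≤ (InformationTheory.klDiv P (condProd f N)).toReal +
      (Real.log C + b * cgf φ (tensorPower (density f) k) t) := by
  have := hf.isProbabilityMeasure
  set B : Fin b → KacSphere N → Fin k → ℝ := fun i v j =>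
    v.1 (Fin.castLE hbk (finProdFinEquiv (i, j))) with hB
  have hBm : ∀ i, Measurable (B i) := fun i => measurable_coords _
  have hBlaw : ∀ i, P.map (B i) = marginal k P := fun i =>
    map_coords_eq_marginal hP hk fun j j' h => by
      have := finProdFinEquiv.injective (Fin.castLE_injective hbk h)
      simpa using this
  have hi : ∀ i, Integrable (fun v => φ (B i v)) P := fun i => by
    have h := hφi
    rw [← hBlaw i, integrable_map_measure hφ.aestronglyMeasurable (hBm i).aemeasurable] at h
    exact h
  have h_int : ∀ i, ∫ v, φ (B i v) ∂P = ∫ x, φ x ∂(marginal k P) := fun i => by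
    rw [← hBlaw i, integral_map (hBm i).aemeasurable hφ.aestronglyMeasurable]
  -- Under the product measure the exponential moment of this sum factorizes into a `b`-th power,
  -- while passing to that measure costs the factor `C` only once.
  set G : KacSphere N → ℝ := fun v => ∑ i, t * φ (B i v) with hG
  have hGm : Measurable G := Finset.measurable_sum _ fun i _ => (hφ.comp (hBm i)).const_mul t
  have hGi : Integrable G P := integrable_finsetSum _ fun i _ => (hi i).const_mul t
  have hGint : ∫ v, G v ∂P = b * (t * ∫ x, φ x ∂(marginal k P)) := by
    rw [hG, integral_finsetSum _ fun i _ => (hi i).const_mul t]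
    simp only [integral_const_mul, h_int, Finset.sum_const, Finset.card_univ, Fintype.card_fin,
      nsmul_eq_mul]
  have hM : 0 < mgf φ (tensorPower (density f) k) t := mgf_pos hexp
  have hlint : ∫⁻ v, ENNReal.ofReal (Real.exp (G v)) ∂(condProd f N) ≤
      ENNReal.ofReal (C * mgf φ (tensorPower (density f) k) t ^ b) := by
    have hH : Measurable fun x => ENNReal.ofReal (Real.exp (t * φ x)) := by fun_prop
    have h1 := hle (fun x => ∏ i : Fin b, ENNReal.ofReal
      (Real.exp (t * φ (fun j => x (finProdFinEquiv (i, j))))))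
      (Finset.measurable_prod _ fun i _ => hH.comp (by fun_prop))
    rw [lintegral_blocks _ b k hH, ← ofReal_integral_eq_lintegral_ofReal hexp
      (ae_of_all _ fun _ => (Real.exp_pos _).le), ← ENNReal.ofReal_pow (integral_nonneg
        fun _ => (Real.exp_pos _).le), ← ENNReal.ofReal_mul hC.le] at h1
    refine le_trans (le_of_eq (lintegral_congr fun v => ?_)) h1
    rw [← ENNReal.ofReal_prod_of_nonneg fun _ _ => (Real.exp_pos _).le, ← Real.exp_sum]
  have hexpG : Integrable (fun v => Real.exp (G v)) (condProd f N) := by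
    refine ⟨by fun_prop, ?_⟩
    rw [hasFiniteIntegral_iff_ofReal (ae_of_all _ fun _ => (Real.exp_pos _).le)]
    exact lt_of_le_of_lt hlint ENNReal.ofReal_lt_top
  have hle2 : ∫ v, Real.exp (G v) ∂(condProd f N) ≤
      C * mgf φ (tensorPower (density f) k) t ^ b := by
    rw [integral_eq_lintegral_of_nonneg_ae (ae_of_all _ fun _ => (Real.exp_pos _).le) hexpG.1]
    exact ENNReal.toReal_le_of_le_ofReal (by positivity) hlint
  rw [← hGint]
  refine (integral_le_klDiv_add_log hkl hGi hexpG).trans ?_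
  gcongr
  refine (Real.log_le_log (integral_exp_pos hexpG) hle2).trans_eq ?_
  rw [Real.log_mul hC.ne' (by positivity), Real.log_pow, cgf]

end

/-! ### Chaos from entropic closeness to the conditioned product. -/

section

variable {f : ℝ → ℝ}

lemma eventually_ne_top_of_tendsto_div {u : ℕ → ℝ≥0∞}
    (hu : Tendsto (fun N : ℕ => u N / (N : ℝ≥0∞)) atTop (𝓝 0)) : ∀ᶠ N in atTop, u N ≠ ⊤ := by
  filter_upwards [hu.eventually_lt_const ENNReal.zero_lt_top] with N hN h
  rw [h, ENNReal.top_div_of_ne_top (ENNReal.natCast_ne_top N)] at hN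
  exact lt_irrefl _ hN

lemma tendsto_toReal_div_natCast {u : ℕ → ℝ≥0∞}
    (hu : Tendsto (fun N : ℕ => u N / (N : ℝ≥0∞)) atTop (𝓝 0)) :
    Tendsto (fun N : ℕ => (u N).toReal / N) atTop (𝓝 0) := by
  have h := (ENNReal.tendsto_toReal ENNReal.zero_ne_top).comp hu
  simpa [Function.comp_def, ENNReal.toReal_div] using h

lemma tendsto_log_mul_sqrt_div {C : ℝ} (hC : 0 < C) :
    Tendsto (fun N : ℕ => Real.log (C * √(N : ℝ)) / N) atTop (𝓝 0) := by
  have h1 : Tendsto (fun N : ℕ => Real.log N / (N : ℝ)) atTop (𝓝 0) :=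
    (Real.isLittleO_log_id_atTop.tendsto_div_nhds_zero).comp tendsto_natCast_atTop_atTop
  have h2 : Tendsto (fun N : ℕ => Real.log C / (N : ℝ)) atTop (𝓝 0) :=
    tendsto_const_div_atTop_nhds_zero_nat _
  have h3 := h2.add (h1.div_const 2)
  simp only [zero_div, add_zero] at h3
  refine h3.congr' ?_
  filter_upwards [eventually_gt_atTop 0] with N hN
  have hN' : (0 : ℝ) < N := by exact_mod_cast hN
  rw [Real.log_mul hC.ne' (Real.sqrt_pos.2 hN').ne', Real.log_sqrt hN'.le]
  ring

/-- Fix `t` with `cgf(t)/t < a`; the block bound divided by `bt` is then this quotient plus an error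
that vanishes because `b` is of order `N`. -/
lemma eventually_integral_marginal_lt (hf : IsKacDensity f) {k : ℕ} (hk : 0 < k) {N₁ : ℕ}
    {m : (N : ℕ) → Measure (KacSphere N)} (hm : IsSymmFamily N₁ m)
    (hkl : Tendsto (fun N : ℕ => InformationTheory.klDiv (m N) (condProd f N) / (N : ℝ≥0∞))
      atTop (𝓝 0))
    {φ : (Fin k → ℝ) → ℝ} (hφ : Measurable φ) {l : ℝ} (hl : 0 < l)
    (hexp : Integrable (fun x => Real.exp (l * |φ x|)) (tensorPower (density f) k))
    {a : ℝ} (ha : ∫ x, φ x ∂(tensorPower (density f) k) < a) :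
    ∀ᶠ N in atTop, Integrable φ (marginal k (m N)) ∧ ∫ x, φ x ∂(marginal k (m N)) < a := by
  have := hf.isProbabilityMeasure
  obtain ⟨C, hC, N₀, hle⟩ := exists_lintegral_condProd_le hf
  obtain ⟨N₂, -, hZ⟩ := exists_Z_pos_lt_top hf
  obtain ⟨t, ht, htl, hta⟩ := exists_cgf_div_lt hφ hl hexp ha
  set c := cgf φ (tensorPower (density f) k) t
  have hlim : Tendsto (fun N : ℕ => ((InformationTheory.klDiv (m N) (condProd f N)).toReal / N +
      |Real.log (C * √(N : ℝ)) / N|) * (2 * k / t) + c / t) atTop (𝓝 (c / t)) := by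
    have h := (((tendsto_toReal_div_natCast hkl).add (tendsto_log_mul_sqrt_div hC).abs).mul_const
      (2 * k / t)).add_const (c / t)
    simpa using h
  filter_upwards [hlim.eventually_lt_const hta, eventually_ne_top_of_tendsto_div hkl,
    eventually_ge_atTop N₀, eventually_ge_atTop N₁, eventually_ge_atTop N₂,
    eventually_ge_atTop (10 + 2 * k)] with N h1 h2 h3 h4 h5 h6
  have := (hm N h4).1
  have := isProbabilityMeasure_condProd (hZ N h5)
  have hN : (0 : ℝ) < N := by exact_mod_cast (by omega : 0 < N)
  have hk' : (0 : ℝ) < k := by exact_mod_cast hk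
  -- As many blocks as fit while leaving the five coordinates needed for domination; `N ≥ 10 + 2k`
  -- then ensures `N ≤ 2kb`.
  set b := (N - 5) / k with hb
  have hbk : b * k ≤ N - 5 := Nat.div_mul_le_self _ _
  have hbk' : N - 5 < (b + 1) * k := by
    have := Nat.lt_div_mul_add (a := N - 5) hk
    rw [add_mul, one_mul]; exact this
  have hbR : (N : ℝ) ≤ 2 * k * b := by
    have : N ≤ 2 * k * b := by
      have e : (b + 1) * k = b * k + k := by ring
      have e' : 2 * k * b = 2 * (b * k) := by ring
      omega
    exact_mod_cast this
  have hb0 : (0 : ℝ) < b := by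
    by_contra h
    have : (b : ℝ) = 0 := le_antisymm (not_lt.1 h) (Nat.cast_nonneg b)
    rw [this, mul_zero] at hbR
    linarith
  have hφi : Integrable φ (marginal k (m N)) :=
    integrable_comp_first_of_klDiv_ne_top (by omega) (hle N h3 k (by omega)) h2 hφ hl hexp
  refine ⟨hφi, lt_of_le_of_lt ?_ h1⟩
  have key := mul_integral_marginal_le hf (C := C * √(N : ℝ)) (b := b)
    (mul_pos hC (Real.sqrt_pos.2 hN)) (by omega) (by omega) (hm N h4).2
    (hle N h3 (b * k) (by omega)) h2 hφ hφi
    (integrable_exp_of_integrable_exp_abs hφ hexp (by rwa [abs_of_pos ht]))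
  set I := ∫ x, φ x ∂(marginal k (m N))
  set H := (InformationTheory.klDiv (m N) (condProd f N)).toReal
  have hH : 0 ≤ H := ENNReal.toReal_nonneg
  set R := Real.log (C * √(N : ℝ))
  have hR : R ≤ |R| := le_abs_self R
  have e1 : (H / N + |R / N|) * (2 * k / t) + c / t =
      ((H + |R|) * (2 * k) / N + c) / t := by
    rw [abs_div, abs_of_pos hN]
    field_simp
  rw [e1, le_div_iff₀ ht]
  have h7 : (H + |R|) ≤ b * ((H + |R|) * (2 * k) / N) := by
    have : b * ((H + |R|) * (2 * k) / N) = (H + |R|) * ((2 * k * b) / N) := by ring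
    rw [this]
    exact le_mul_of_one_le_right (by positivity) ((one_le_div hN).2 hbR)
  refine le_of_mul_le_mul_left ?_ hb0
  linarith [mul_comm I t]

/-- Entropic closeness to the conditioned tensor products forces convergence of the integrals of
exponentially integrable observables. -/
theorem tendsto_integral_marginal (hf : IsKacDensity f) {k : ℕ} (hk : 0 < k) {N₁ : ℕ}
    {m : (N : ℕ) → Measure (KacSphere N)} (hm : IsSymmFamily N₁ m)
    (hkl : Tendsto (fun N : ℕ => InformationTheory.klDiv (m N) (condProd f N) / (N : ℝ≥0∞))
      atTop (𝓝 0))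
    {φ : (Fin k → ℝ) → ℝ} (hφ : Measurable φ) {l : ℝ} (hl : 0 < l)
    (hexp : Integrable (fun x => Real.exp (l * |φ x|)) (tensorPower (density f) k)) :
    (∀ᶠ N in atTop, Integrable φ (marginal k (m N))) ∧
    Tendsto (fun N => ∫ x, φ x ∂(marginal k (m N))) atTop
      (𝓝 (∫ x, φ x ∂(tensorPower (density f) k))) := by
  refine ⟨(eventually_integral_marginal_lt hf hk hm hkl hφ hl hexp (lt_add_one _)).mono
    fun N h => h.1, tendsto_order.2 ⟨fun a ha => ?_, fun a ha =>
    (eventually_integral_marginal_lt hf hk hm hkl hφ hl hexp ha).mono fun N h => h.2⟩⟩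
  have h := eventually_integral_marginal_lt hf hk hm hkl hφ.neg hl (by simpa using hexp)
    (a := -a) (by simpa [integral_neg] using ha)
  filter_upwards [h] with N hN
  simpa [integral_neg] using hN.2

theorem isChaotic_of_tendsto_klDiv (hf : IsKacDensity f) {N₁ : ℕ}
    {m : (N : ℕ) → Measure (KacSphere N)} (hm : IsSymmFamily N₁ m)
    (hkl : Tendsto (fun N : ℕ => InformationTheory.klDiv (m N) (condProd f N) / (N : ℝ≥0∞))
      atTop (𝓝 0)) : IsChaotic (density f) N₁ m where
  symm := hm
  tendsto k hk χ := by
    have := hf.isProbabilityMeasure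
    refine (tendsto_integral_marginal hf hk hm hkl χ.continuous.measurable one_pos ?_).2
    refine Integrable.of_bound (C := Real.exp ‖χ‖)
      (by have := χ.continuous; exact Continuous.aestronglyMeasurable (by fun_prop))
      (ae_of_all _ fun x => ?_)
    rw [Real.norm_of_nonneg (Real.exp_pos _).le, one_mul]
    exact Real.exp_le_exp.2 (χ.norm_coe_le_norm x)

end

/-! ### The entropy limit. -/

section

variable {f : ℝ → ℝ}

/-- Change of reference measure in the relative entropy. -/
lemma klDiv_eq_add_integral_log {α : Type*} [MeasurableSpace α] {P R : Measure α}
    [IsProbabilityMeasure P] [IsProbabilityMeasure R] {q : α → ℝ≥0∞} (hq : Measurable q)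
    (hq_top : ∀ x, q x ≠ ⊤) [IsProbabilityMeasure (R.withDensity q)]
    (hkl : InformationTheory.klDiv P (R.withDensity q) ≠ ⊤)
    (h_int : Integrable (fun x => Real.log (q x).toReal) P) :
    InformationTheory.klDiv P R = ENNReal.ofReal
      ((InformationTheory.klDiv P (R.withDensity q)).toReal + ∫ x, Real.log (q x).toReal ∂P) := by
  obtain ⟨hac, hllr⟩ := InformationTheory.klDiv_ne_top_iff.1 hkl
  have hacR : R.withDensity q ≪ R := withDensity_absolutelyContinuous _ _
  have hPR := hac.trans hacR
  have hae : llr P R =ᵐ[P] fun x => llr P (R.withDensity q) x + Real.log (q x).toReal := by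
    have h1 := hPR.ae_le (Measure.rnDeriv_mul_rnDeriv hac (κ := R))
    have h2 := hPR.ae_le (Measure.rnDeriv_withDensity R hq)
    have h3 := hac.ae_le (Measure.rnDeriv_pos hacR)
    have h4 := Measure.rnDeriv_pos hac
    have h5 := hac.ae_le (Measure.rnDeriv_lt_top P (R.withDensity q))
    filter_upwards [h1, h2, h3, h4, h5] with x h1 h2 h3 h4 h5
    rw [llr, llr, ← h1, Pi.mul_apply, ENNReal.toReal_mul, h2, Real.log_mul]
    · exact (ENNReal.toReal_pos h4.ne' h5.ne).ne'
    · exact (ENNReal.toReal_pos (h2 ▸ h3.ne') (hq_top x)).ne'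
  have hi : Integrable (llr P R) P := (hllr.add h_int).congr hae.symm
  rw [InformationTheory.klDiv_of_ac_of_integrable hPR hi,
    InformationTheory.toReal_klDiv_of_measure_eq hac (by simp), integral_congr_ae hae,
    integral_add hllr h_int]
  simp

/-- With exponent `1/2` the integrand is at most `f (√f + 1/√f) = f√f + √f` where `f > 0`. The first
term is controlled by boundedness; for the second, the arithmetic-geometric inequality gives `2√f ≤
f (1 + v²) + 1/(1 + v²)`, integrable by the second moment. -/
lemma integrable_exp_log_density (hf : IsKacDensity f) :
    Integrable (fun v => Real.exp (1 / 2 * |Real.log (f v)|)) (density f) := by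
  obtain ⟨M, hM⟩ := hf.bdd
  rw [hf.integrable_density_iff]
  have hfm := hf.measurable
  have hdom : Integrable fun v => f v * √M + (f v + f v * v ^ 2 + (1 + v ^ 2)⁻¹) / 2 :=
    (hf.integrable.mul_const _).add
      (((hf.integrable.add hf.integrable_two).add integrable_inv_one_add_sq).div_const 2)
  refine hdom.mono' (Measurable.aestronglyMeasurable (by fun_prop)) (ae_of_all _ fun v => ?_)
  rw [Real.norm_of_nonneg (mul_nonneg (hf.nonneg v) (Real.exp_pos _).le)]
  have hw : 0 < 1 + v ^ 2 := by positivity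
  rcases (hf.nonneg v).eq_or_lt with h0 | h0
  · rw [← h0]; simp; positivity
  set s := √(f v) with hs
  have hs0 : 0 < s := Real.sqrt_pos.2 h0
  have hsf : s ^ 2 = f v := Real.sq_sqrt h0.le
  have hsM : s ≤ √M := Real.sqrt_le_sqrt (hM v)
  have hexp : Real.exp (1 / 2 * |Real.log (f v)|) ≤ s + s⁻¹ := by
    have hlog : 1 / 2 * Real.log (f v) = Real.log s := by rw [hs, Real.log_sqrt h0.le]; ring
    rcases abs_cases (Real.log (f v)) with ⟨h, -⟩ | ⟨h, -⟩ <;> rw [h]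
    · rw [hlog, Real.exp_log hs0]; linarith [inv_pos.2 hs0]
    · rw [mul_neg, hlog, Real.exp_neg, Real.exp_log hs0]; linarith
  have hyoung : s ≤ (f v + f v * v ^ 2 + (1 + v ^ 2)⁻¹) / 2 := by
    rw [← hsf]
    have h1 : 0 ≤ (s * (1 + v ^ 2) - 1) ^ 2 / (1 + v ^ 2) := by positivity
    have h2 : (s * (1 + v ^ 2) - 1) ^ 2 / (1 + v ^ 2) =
        s ^ 2 + s ^ 2 * v ^ 2 + (1 + v ^ 2)⁻¹ - 2 * s := by field_simp; ring
    linarith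
  calc f v * Real.exp (1 / 2 * |Real.log (f v)|) ≤ f v * (s + s⁻¹) := by gcongr
    _ = f v * s + s := by rw [← hsf]; field_simp
    _ ≤ _ := by gcongr

lemma integrable_log_density (hf : IsKacDensity f) :
    Integrable (fun v => Real.log (f v)) (density f) := by
  have hfm := hf.measurable
  refine ((integrable_exp_log_density hf).const_mul 2).mono'
    (Measurable.aestronglyMeasurable (by fun_prop)) (ae_of_all _ fun v => ?_)
  rw [Real.norm_eq_abs]
  linarith [Real.add_one_le_exp (1 / 2 * |Real.log (f v)|)]

/-- Makes the local limit available for the Gaussian, the reference case in which `Z` is explicit.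
-/
lemma isKacDensity_gaussian : IsKacDensity (gaussianPDFReal 0 1) where
  measurable := measurable_gaussianPDFReal 0 1
  nonneg := gaussianPDFReal_nonneg 0 1
  bdd := ⟨(√(2 * π * (1 : ℝ≥0)))⁻¹, fun v => by
    rw [gaussianPDFReal]
    refine mul_le_of_le_one_right (by positivity) (Real.exp_le_one_iff.2 ?_)
    rw [neg_div]
    exact neg_nonpos.2 (by positivity)⟩
  one := integral_gaussianPDFReal_eq_one 0 one_ne_zero
  two := by
    have h := variance_id_gaussianReal (μ := 0) (v := 1)
    rw [variance_eq_integral measurable_id.aemeasurable] at h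
    simp only [id, integral_id_gaussianReal, sub_zero] at h
    rw [integral_gaussianReal_eq_integral_smul one_ne_zero] at h
    simpa using h
  four := by
    have h := (memLp_id_gaussianReal (μ := 0) (v := 1) 4).integrable_norm_pow (by norm_num)
    rw [gaussianReal_of_var_ne_zero 0 one_ne_zero] at h
    have h' := (integrable_withDensity_iff (measurable_gaussianPDF 0 1)
      (ae_of_all _ fun _ => ENNReal.ofReal_lt_top)).1 h
    refine h'.congr (ae_of_all _ fun v => ?_)
    simp only [id, gaussianPDF, ENNReal.toReal_ofReal (gaussianPDFReal_nonneg 0 1 v),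
      Real.norm_eq_abs]
    rw [show |v| ^ 4 = v ^ 4 from (by decide : Even 4).pow_abs v, mul_comm]

lemma log_gaussianPDFReal (v : ℝ) :
    Real.log (gaussianPDFReal 0 1 v) = -(Real.log (2 * π) / 2) - v ^ 2 / 2 := by
  rw [gaussianPDFReal, Real.log_mul (by positivity) (Real.exp_pos _).ne', Real.log_exp,
    Real.log_inv, Real.log_sqrt (by positivity)]
  simp
  ring

lemma sum_sq_coord {N : ℕ} (v : KacSphere N) : ∑ j, v.1 j ^ 2 = N := by
  have h := norm_eq_of_mem_sphere v
  rw [EuclideanSpace.norm_eq, Real.sqrt_inj (by positivity) (by positivity)] at h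
  simpa using h

lemma Z_gaussian {N : ℕ} (hN : N ≠ 0) :
    Z (gaussianPDFReal 0 1) N = ENNReal.ofReal (Real.exp (-(N * ((Real.log (2 * π) + 1) / 2)))) := by
  have := isProbabilityMeasure_unif hN
  have h : ∀ v : KacSphere N, ∏ j, ENNReal.ofReal (gaussianPDFReal 0 1 (v.1 j)) =
      ENNReal.ofReal (Real.exp (-(N * ((Real.log (2 * π) + 1) / 2)))) := fun v => by
    rw [← ENNReal.ofReal_prod_of_nonneg fun _ _ => gaussianPDFReal_nonneg _ _ _]
    congr 1
    rw [← Real.exp_log (Finset.prod_pos fun j _ => gaussianPDFReal_pos 0 1 (v.1 j) one_ne_zero),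
      Real.log_prod fun j _ => (gaussianPDFReal_pos 0 1 (v.1 j) one_ne_zero).ne']
    congr 1
    simp only [log_gaussianPDFReal, Finset.sum_sub_distrib, ← Finset.sum_div, sum_sq_coord,
      Finset.sum_const, Finset.card_univ, Fintype.card_fin, nsmul_eq_mul]
    ring
  rw [Z]
  simp only [h, lintegral_const, measure_univ, mul_one]

lemma toReal_Z_eq (hf : IsKacDensity f) (n : ℕ) :
    (Z f (n + 1)).toReal = (sliceConst n).toReal * (sumSqDensity f n ((n : ℝ) + 1)).toReal := by
  rw [Z_eq hf, ENNReal.toReal_mul]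

/-- The exponential rate of the normalization does not depend on the density. -/
theorem tendsto_log_Z_div (hf : IsKacDensity f) :
    Tendsto (fun N : ℕ => Real.log (Z f N).toReal / N) atTop
      (𝓝 (-((Real.log (2 * π) + 1) / 2))) := by
  obtain ⟨L, hL, hlim, -⟩ := sumSqDensity_asymptotics hf
  obtain ⟨L', hL', hlim', -⟩ := sumSqDensity_asymptotics isKacDensity_gaussian
  -- In the difference of the two values of `log Z` the constant `sliceConst` cancels, leaving a
  -- convergent sequence that vanishes after division by `N`.
  have h1 := ((hlim 1).log hL.ne').sub ((hlim' 1).log hL'.ne')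
  have hinv : Tendsto (fun n : ℕ => (((n + 1 : ℕ) : ℝ))⁻¹) atTop (𝓝 0) :=
    (tendsto_add_atTop_iff_nat 1).2 tendsto_inv_atTop_nhds_zero_nat
  have h2 := (h1.mul hinv).add_const (-((Real.log (2 * π) + 1) / 2))
  rw [mul_zero, zero_add] at h2
  refine (tendsto_add_atTop_iff_nat 1).1 (h2.congr' ?_)
  filter_upwards [(hlim 1).eventually_const_lt hL, (hlim' 1).eventually_const_lt hL'] with n h3 h4
  have hn : (0 : ℝ) < ((n + 1 : ℕ) : ℝ) := by positivity
  have hs : 0 < (sliceConst n).toReal :=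
    ENNReal.toReal_pos (sliceConst_ne_zero n) (sliceConst_ne_top n)
  have h5 := right_ne_zero_of_mul h3.ne'
  have h6 := right_ne_zero_of_mul h4.ne'
  have h7 := left_ne_zero_of_mul h3.ne'
  have h8 := congrArg Real.log (toReal_Z_eq isKacDensity_gaussian n)
  rw [Z_gaussian n.succ_ne_zero, ENNReal.toReal_ofReal (Real.exp_pos _).le, Real.log_exp,
    Real.log_mul hs.ne' h6] at h8
  rw [toReal_Z_eq hf, Real.log_mul hs.ne' h5, Real.log_mul h7 h5, Real.log_mul h7 h6]
  field_simp
  linarith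

/-- The log-density relative to the Gaussian is `log f + log(2π)/2 + v²/2`, and the unit second
moment evaluates the last term. -/
lemma klDiv_density_gaussian (hf : IsKacDensity f) :
    InformationTheory.klDiv (density f) (gaussianReal 0 1) = ENNReal.ofReal
      (∫ v, Real.log (f v) ∂(density f) + (Real.log (2 * π) + 1) / 2) := by
  have := hf.isProbabilityMeasure
  set q : ℝ → ℝ≥0∞ := fun v => ENNReal.ofReal (f v / gaussianPDFReal 0 1 v) with hq
  have hfm := hf.measurable
  have hqm : Measurable q := (hfm.div (measurable_gaussianPDFReal 0 1)).ennreal_ofReal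
  have heq : (gaussianReal 0 1).withDensity q = density f := by
    rw [gaussianReal_of_var_ne_zero 0 one_ne_zero,
      ← withDensity_mul _ (measurable_gaussianPDF 0 1) hqm, density]
    congr 1
    ext v
    have hp := gaussianPDFReal_pos 0 1 v one_ne_zero
    rw [Pi.mul_apply, hq, gaussianPDF, ← ENNReal.ofReal_mul hp.le, mul_div_cancel₀ _ hp.ne']
  have hpos : ∀ᵐ v ∂(density f), 0 < f v := by
    rw [density, ae_withDensity_iff hf.measurable_ofReal]
    exact ae_of_all _ fun v hv => ENNReal.ofReal_pos.1 (pos_iff_ne_zero.2 hv)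
  have hae : (fun v => Real.log (q v).toReal) =ᵐ[density f]
      fun v => Real.log (f v) + (Real.log (2 * π) / 2 + v ^ 2 / 2) := by
    filter_upwards [hpos] with v hv
    have hp := gaussianPDFReal_pos 0 1 v one_ne_zero
    rw [hq, ENNReal.toReal_ofReal (div_pos hv hp).le, Real.log_div hv.ne' hp.ne',
      log_gaussianPDFReal]
    ring
  have hsq : Integrable (fun v : ℝ => v ^ 2) (density f) :=
    hf.integrable_density_iff.2 hf.integrable_two
  have hi2 : Integrable (fun v : ℝ => Real.log (2 * π) / 2 + v ^ 2 / 2) (density f) :=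
    (integrable_const _).add (hsq.div_const 2)
  have : IsProbabilityMeasure ((gaussianReal 0 1).withDensity q) := by rwa [heq]
  have h := klDiv_eq_add_integral_log (P := density f) (R := gaussianReal 0 1) hqm
    (fun _ => ENNReal.ofReal_ne_top) (by rw [heq, InformationTheory.klDiv_self]; simp)
    (((integrable_log_density hf).add hi2).congr hae.symm)
  rw [h, heq, InformationTheory.klDiv_self, integral_congr_ae hae,
    integral_add (integrable_log_density hf) hi2, integral_add (integrable_const _)
    (hsq.div_const 2), integral_div 2 fun v : ℝ => v ^ 2, hf.integral_density (fun v => v ^ 2),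
    hf.two]
  congr 1
  simp
  ring

lemma ae_condProd_pos (hf : IsKacDensity f) (N : ℕ) :
    ∀ᵐ v ∂(condProd f N), ∀ j, 0 < f (v.1 j) := by
  have hp := measurable_prod_coord hf N
  rw [condProd, ae_withDensity_iff (by fun_prop)]
  refine ae_of_all _ fun v hv j => ENNReal.ofReal_pos.1 (pos_iff_ne_zero.2 ?_)
  exact Finset.prod_ne_zero_iff.1 (ENNReal.div_ne_zero.1 hv).1 j (Finset.mem_univ j)

/-- Changing the reference measure adds the mean of `∑ log f(v_j) - log Z_N`; by symmetry all `N`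
summands have the same mean. -/
lemma klDiv_unif_eq (hf : IsKacDensity f) {N : ℕ} (hN : 1 ≤ N)
    (hZ : 0 < Z f N ∧ Z f N < ⊤) {P : Measure (KacSphere N)} [IsProbabilityMeasure P]
    (hP : IsSymm P) (hkl : InformationTheory.klDiv P (condProd f N) ≠ ⊤)
    (h_int : Integrable (fun x : Fin 1 → ℝ => Real.log (f (x 0))) (marginal 1 P)) :
    InformationTheory.klDiv P (unif N) = ENNReal.ofReal
      ((InformationTheory.klDiv P (condProd f N)).toReal +
        (N * ∫ x, Real.log (f (x 0)) ∂(marginal 1 P) - Real.log (Z f N).toReal)) := by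
  have := isProbabilityMeasure_unif (N := N) (by omega)
  have hQ := isProbabilityMeasure_condProd hZ
  have hfm := hf.measurable
  have hφ : Measurable fun x : Fin 1 → ℝ => Real.log (f (x 0)) := by fun_prop
  have hp := measurable_prod_coord hf N
  have hac := (InformationTheory.klDiv_ne_top_iff.1 hkl).1
  have hlaw : ∀ j : Fin N, P.map (fun v (_ : Fin 1) => v.1 j) = marginal 1 P := fun j =>
    map_coords_eq_marginal hP hN (e := fun _ => j) (Function.injective_of_subsingleton _)
  have hm : ∀ j : Fin N, Measurable fun (v : KacSphere N) (_ : Fin 1) => v.1 j :=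
    fun j => measurable_coords _
  have hi : ∀ j : Fin N, Integrable (fun v : KacSphere N => Real.log (f (v.1 j))) P := fun j => by
    have h := h_int
    rw [← hlaw j, integrable_map_measure hφ.aestronglyMeasurable (hm j).aemeasurable] at h
    exact h
  have hI : ∀ j : Fin N, ∫ v : KacSphere N, Real.log (f (v.1 j)) ∂P =
      ∫ x, Real.log (f (x 0)) ∂(marginal 1 P) := fun j => by
    rw [← hlaw j, integral_map (hm j).aemeasurable hφ.aestronglyMeasurable]
  have hpos : ∀ᵐ v ∂P, ∀ j, 0 < f (v.1 j) := hac.ae_le (ae_condProd_pos hf N)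
  have hae : (fun v : KacSphere N => Real.log
      ((∏ j, ENNReal.ofReal (f (v.1 j))) / Z f N).toReal) =ᵐ[P]
      fun v => ∑ j, Real.log (f (v.1 j)) - Real.log (Z f N).toReal := by
    filter_upwards [hpos] with v hv
    rw [ENNReal.toReal_div, ENNReal.toReal_prod, Real.log_div _
      (ENNReal.toReal_pos hZ.1.ne' hZ.2.ne).ne', Real.log_prod]
    · simp only [ENNReal.toReal_ofReal (hv _).le]
    · intro j _; rw [ENNReal.toReal_ofReal (hv j).le]; exact (hv j).ne'
    · refine Finset.prod_ne_zero_iff.2 fun j _ => ?_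
      rw [ENNReal.toReal_ofReal (hv j).le]; exact (hv j).ne'
  have hsum : Integrable (fun v : KacSphere N => ∑ j, Real.log (f (v.1 j))) P :=
    integrable_finsetSum _ fun j _ => hi j
  have hQ' : IsProbabilityMeasure ((unif N).withDensity fun v =>
    (∏ j, ENNReal.ofReal (f (v.1 j))) / Z f N) := hQ
  rw [klDiv_eq_add_integral_log (P := P) (R := unif N)
    (q := fun v => (∏ j, ENNReal.ofReal (f (v.1 j))) / Z f N) (by fun_prop)
    (fun v => ENNReal.div_ne_top (ENNReal.prod_ne_top fun _ _ => ENNReal.ofReal_ne_top) hZ.1.ne')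
    hkl ((hsum.sub (integrable_const _)).congr hae.symm), integral_congr_ae hae,
    integral_sub hsum (integrable_const _), integral_finsetSum _ fun j _ => hi j]
  simp only [hI, integral_const, probReal_univ, Finset.sum_const, Finset.card_univ,
    Fintype.card_fin, nsmul_eq_mul, one_smul]
  rfl

theorem isEntropicallyChaotic_of_tendsto_klDiv (hf : IsKacDensity f) {N₁ : ℕ}
    {m : (N : ℕ) → Measure (KacSphere N)} (hm : IsSymmFamily N₁ m)
    (hkl : Tendsto (fun N : ℕ => InformationTheory.klDiv (m N) (condProd f N) / (N : ℝ≥0∞))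
      atTop (𝓝 0)) : IsEntropicallyChaotic (density f) N₁ m := by
  refine ⟨isChaotic_of_tendsto_klDiv hf hm hkl, ?_⟩
  have := hf.isProbabilityMeasure
  obtain ⟨N₂, -, hZ⟩ := exists_Z_pos_lt_top hf
  have hfm := hf.measurable
  have hφ : Measurable fun x : Fin 1 → ℝ => Real.log (f (x 0)) := by fun_prop
  have hev : MeasurePreserving (fun x : Fin 1 → ℝ => x 0) (tensorPower (density f) 1) (density f) :=
    measurePreserving_eval (fun _ => density f) 0
  obtain ⟨h1, h2⟩ := tendsto_integral_marginal hf one_pos hm hkl hφ one_half_pos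
    (hev.integrable_comp_of_integrable (integrable_exp_log_density hf))
  have h3 : ∫ x, Real.log (f (x 0)) ∂(tensorPower (density f) 1) =
      ∫ v, Real.log (f v) ∂(density f) := by
    have h := integral_map (μ := tensorPower (density f) 1) (f := fun v => Real.log (f v))
      hev.measurable.aemeasurable
      (Measurable.aestronglyMeasurable (by fun_prop))
    rw [← h, hev.map_eq]
  -- Divided by `N`, the three terms of the entropy tend to `0`, `∫ log f dμ` and `(log(2π) + 1)/2`,
  -- whose sum is `H(μ|γ)`.
  have h4 := ENNReal.tendsto_ofReal
    ((tendsto_toReal_div_natCast hkl).add (h2.sub (tendsto_log_Z_div hf)))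
  rw [zero_add, sub_neg_eq_add, h3, ← klDiv_density_gaussian hf] at h4
  refine h4.congr' ?_
  filter_upwards [h1, eventually_ne_top_of_tendsto_div hkl, eventually_ge_atTop N₁,
    eventually_ge_atTop N₂, eventually_ge_atTop 1] with N h5 h6 h7 h8 h9
  have := (hm N h7).1
  have hN : (0 : ℝ) < N := by exact_mod_cast h9
  rw [klDiv_unif_eq hf h9 (hZ N h8) (hm N h7).2 h6 h5, ← ENNReal.ofReal_natCast N,
    ← ENNReal.ofReal_div_of_pos hN]
  congr 1
  field_simp

theorem isEntropicallyChaotic_condProd (hf : IsKacDensity f) {N₀ : ℕ}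
    (hZ : ∀ N, N₀ ≤ N → 0 < Z f N ∧ Z f N < ⊤) :
    IsEntropicallyChaotic (density f) N₀ (condProd f) := by
  refine isEntropicallyChaotic_of_tendsto_klDiv hf
    (fun N hN => ⟨isProbabilityMeasure_condProd (hZ N hN), isSymm_condProd hf N⟩) ?_
  refine tendsto_const_nhds.congr' ?_
  filter_upwards [eventually_ge_atTop N₀] with N hN
  have := isProbabilityMeasure_condProd (hZ N hN)
  rw [InformationTheory.klDiv_self, ENNReal.zero_div]

end

/-! ### Independence of the chosen version of the density. -/

section

/-- Changing `f` on a null set must not affect the conditioned product. This needs `N ≥ 2`: for `N =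
1` the sphere consists of two points. -/
lemma quasiMeasurePreserving_coord {N : ℕ} (hN : 2 ≤ N) (j : Fin N) :
    Measure.QuasiMeasurePreserving (fun v : KacSphere N => v.1 j) (unif N) volume := by
  refine ⟨measurable_coord j, Measure.AbsolutelyContinuous.mk fun s hs h0 => ?_⟩
  obtain ⟨n, rfl⟩ : ∃ n, N = n + 2 := ⟨N - 2, by omega⟩
  -- A coordinate other than the sliced one is integrated against Lebesgue measure, so null sets are
  -- negligible; a transposition carries this to every `j`.
  set i : Fin (n + 1) := 0
  set F : (Fin (n + 2) → ℝ) → ℝ≥0∞ := fun x => s.indicator 1 (x i.castSucc)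
  have hF : Measurable F := (measurable_one.indicator hs).comp (measurable_pi_apply _)
  have h1 := lintegral_unif_comp_perm (Equiv.swap i.castSucc j) hF
  rw [lintegral_unif (n + 1) hF] at h1
  have h2 : ∀ᵐ y : Fin (n + 1) → ℝ, y i ∉ s := by
    have := Measure.quasiMeasurePreserving_eval (fun _ : Fin (n + 1) => (volume : Measure ℝ)) i
    exact this.ae (measure_eq_zero_iff_ae_notMem.1 h0)
  have h3 : ∫⁻ y : Fin (n + 1) → ℝ, sqDensity (fun z => F (append y z))
      (((n + 1 + 1 : ℕ) : ℝ) - ∑ i, y i ^ 2) = 0 := by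
    rw [lintegral_eq_zero_of_ae_eq_zero]
    filter_upwards [h2] with y hy
    simp [F, append_castSucc, hy, sqDensity]
  rw [h3, mul_zero] at h1
  rw [Measure.map_apply (measurable_coord j) hs, ← lintegral_indicator_one (measurable_coord j hs),
    ← h1]
  refine lintegral_congr fun v => ?_
  simp only [F, Equiv.swap_apply_left]
  rfl

variable {f g : ℝ → ℝ}

lemma density_congr (h : f =ᵐ[volume] g) : density f = density g :=
  withDensity_congr_ae (h.mono fun v hv => by simp only [hv])

lemma ae_prod_coord_eq (h : f =ᵐ[volume] g) {N : ℕ} (hN : 2 ≤ N) :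
    (fun v : KacSphere N => ∏ j, ENNReal.ofReal (f (v.1 j))) =ᵐ[unif N]
      fun v => ∏ j, ENNReal.ofReal (g (v.1 j)) := by
  have h1 : ∀ᵐ v ∂(unif N), ∀ j, f (v.1 j) = g (v.1 j) :=
    ae_all_iff.2 fun j => (quasiMeasurePreserving_coord hN j).ae h
  filter_upwards [h1] with v hv
  simp only [hv]

lemma Z_congr (h : f =ᵐ[volume] g) {N : ℕ} (hN : 2 ≤ N) : Z f N = Z g N :=
  lintegral_congr_ae (ae_prod_coord_eq h hN)

lemma condProd_congr (h : f =ᵐ[volume] g) {N : ℕ} (hN : 2 ≤ N) : condProd f N = condProd g N := by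
  rw [condProd, condProd, Z_congr h hN]
  exact withDensity_congr_ae ((ae_prod_coord_eq h hN).mono fun v hv => by simp only [hv])

/-- Truncating a measurable version of `f` between `0` and its essential supremum makes the a.e.
hypotheses hold everywhere. -/
lemma exists_isKacDensity_ae_eq (hf_nonneg : 0 ≤ᵐ[volume] f) (hf_one : ∫ v, f v = 1)
    (hf_two : ∫ v, f v * v ^ 2 = 1) (hf_four : Integrable (fun v => f v * v ^ 4))
    (hf_bdd : MemLp f ⊤ volume) : ∃ g, IsKacDensity g ∧ f =ᵐ[volume] g := by
  set M := (eLpNormEssSup f volume).toReal with hM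
  have hfin : eLpNormEssSup f volume ≠ ⊤ := by
    have := hf_bdd.2
    rw [eLpNorm_exponent_top] at this
    exact this.ne
  set f₁ := hf_bdd.1.mk f
  have hf₁ : Measurable f₁ := hf_bdd.1.stronglyMeasurable_mk.measurable
  set g : ℝ → ℝ := fun v => max 0 (min (f₁ v) M) with hg
  have hfg : f =ᵐ[volume] g := by
    filter_upwards [hf_bdd.1.ae_eq_mk, hf_nonneg, ae_le_eLpNormEssSup (f := f) (μ := volume)]
      with v h1 h2 h3
    have h4 : f v ≤ M := by
      have := ENNReal.toReal_mono hfin h3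
      rw [toReal_enorm] at this
      exact (Real.le_norm_self _).trans this
    simp only [hg, f₁, ← h1, min_eq_left h4]
    exact (max_eq_right h2).symm
  have hM0 : 0 ≤ M := ENNReal.toReal_nonneg
  refine ⟨g, ⟨by fun_prop, fun v => le_max_left _ _, ⟨M, fun v => max_le hM0 (min_le_right _ _)⟩,
    ?_, ?_, ?_⟩, hfg⟩
  · rw [← hf_one]; exact integral_congr_ae hfg.symm
  · rw [← hf_two]; exact integral_congr_ae (hfg.symm.mono fun v hv => by simp only [hv])
  · exact hf_four.congr (hfg.mono fun v hv => by simp only [hv])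

lemma IsEntropicallyChaotic.congr {μ : Measure ℝ} {N₀ : ℕ} {m m' : (N : ℕ) → Measure (KacSphere N)}
    (h : IsEntropicallyChaotic μ N₀ m) (hmm : ∀ N, N₀ ≤ N → m N = m' N) :
    IsEntropicallyChaotic μ N₀ m' where
  symm N hN := hmm N hN ▸ h.symm N hN
  tendsto k hk χ := (h.tendsto k hk χ).congr' <| by
    filter_upwards [eventually_ge_atTop N₀] with N hN
    rw [hmm N hN]
  entropy := h.entropy.congr' <| by
    filter_upwards [eventually_ge_atTop N₀] with N hN
    rw [hmm N hN]

end

end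

end KacChaos

theorem mainTheorem2 (f : ℝ → ℝ)
    (hf_nonneg : 0 ≤ᵐ[MeasureTheory.volume] f)
    (hf_one : ∫ v, f v = 1)
    (hf_two : ∫ v, f v * v ^ 2 = 1)
    (hf_four : MeasureTheory.Integrable (fun v => f v * v ^ 4) MeasureTheory.volume)
    (hf_bdd : MeasureTheory.MemLp f ⊤ MeasureTheory.volume) :
    (∃ N₀ : ℕ, 1 ≤ N₀ ∧
      (∀ N, N₀ ≤ N → 0 < KacChaos.Z f N ∧ KacChaos.Z f N < ⊤) ∧
      KacChaos.IsEntropicallyChaotic (KacChaos.density f) N₀ (KacChaos.condProd f)) ∧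
    (∀ k : ℕ, 0 < k →
      Filter.Tendsto
        (fun N : ℕ => InformationTheory.klDiv (KacChaos.marginal k (KacChaos.condProd f N))
          (KacChaos.tensorPower (KacChaos.density f) k))
        Filter.atTop (nhds 0)) ∧
    (∀ (N₁ : ℕ) (m : (N : ℕ) → MeasureTheory.Measure (KacChaos.KacSphere N)),
      1 ≤ N₁ → KacChaos.IsSymmFamily N₁ m →
      Filter.Tendsto
        (fun N : ℕ => InformationTheory.klDiv (m N) (KacChaos.condProd f N) / (N : ENNReal))
        Filter.atTop (nhds 0) →
      KacChaos.IsEntropicallyChaotic (KacChaos.density f) N₁ m) := by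
  obtain ⟨g, hg, hfg⟩ := KacChaos.exists_isKacDensity_ae_eq hf_nonneg hf_one hf_two hf_four hf_bdd
  rw [KacChaos.density_congr hfg]
  refine ⟨?_, fun k _ => ?_, fun N₁ m _ hm hkl => ?_⟩
  · obtain ⟨N₀, hN₀, hZ⟩ := KacChaos.exists_Z_pos_lt_top hg
    refine ⟨N₀, by omega, fun N hN => ?_, (KacChaos.isEntropicallyChaotic_condProd hg hZ).congr
      fun N hN => (KacChaos.condProd_congr hfg (by omega)).symm⟩
    rw [KacChaos.Z_congr hfg (by omega)]
    exact hZ N hN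
  · refine (KacChaos.tendsto_klDiv_marginal_condProd hg k).congr' ?_
    filter_upwards [Filter.eventually_ge_atTop 2] with N hN
    rw [KacChaos.condProd_congr hfg hN]
  · refine KacChaos.isEntropicallyChaotic_of_tendsto_klDiv hg hm (hkl.congr' ?_)
    filter_upwards [Filter.eventually_ge_atTop 2] with N hN
    rw [KacChaos.condProd_congr hfg hN]
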